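/- **Problem.** Let $\xi\sim P$ on a probability space, let $\mathcal X\subset\mathbb R^d$ be convex and compact with diameter $D$, let $A(\xi)$ be a random $m\times d$ matrix with $L_A:=\sup_\xi\|A(\xi)\|^2<\infty$ (spectral norm), and let $b(\xi)\subset\mathbb R^m$ be a random nonempty closed convex set. Let $f(\cdot,\xi):\mathbb R^d\to\mathbb R$ be convex with $L_f$-Lipschitz gradient and with $\mathbb E[\nabla f(x,\xi)]=\nabla f(x)$, where $f(x):=\mathbb E[f(x,\xi)]$. Consider $\min_{x\in\mathcal X} f(x)$ subject to $A(\xi)x\in b(\xi)$ almost surely, with a solution $x^*$. Assume Slater's condition: $0\in\operatorname{sri}(\operatorname{dom}G-A\mathcal X)$ in $L^2(P;\mathbb R^m)$, where $(Ax)(\xi)=A(\xi)x$, $\operatorname{dom}G$ is the set of $y\in L^2(P;\mathbb R^m)$ with $y(\xi)\in b(\xi)$ a.s., and $\operatorname{sri}$ is the strong relative interior. Put $F_\beta(x,\xi)=f(x,\xi)+\frac1{2\beta}\operatorname{dist}(A(\xi)x,b(\xi))^2$ and $S_\beta(x)=\mathbb E[F_\beta(x,\xi)]-f(x^*)$. For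 a batch $B$ of samples, $\tilde\nabla F_\beta(x,B)$ is the average over $B$ of the gradients in $x$ of $F_\beta(x,\cdot)$. **Algorithm (H-SPIDER-FW).** Fix $\beta_0>0$ and $x_{1,1}\in\mathcal X$. For $t\ge1$ and $1\le k\le K_t:=2^{t-1}$ let $\gamma_{t,k}=\frac{2}{K_t+k}$ and $\beta_{t,k}=\frac{\beta_0}{\sqrt{K_t+k}}$. In epoch $t$ set $v_{t,1}=\tilde\nabla F_{\beta_{t,1}}(x_{t,1},Q_t)$ and, for $2\le k\le K_t$, draw a batch $S_{t,k}$ of $K_t$ fresh i.i.d. samples of $P$ and set $$v_{t,k}=v_{t,k-1}-\tilde\nabla F_{\beta_{t,k-1}}(x_{t,k-1},S_{t,k})+\tilde\nabla F_{\beta_{t,k}}(x_{t,k},S_{t,k}).$$ For $1\le k\le K_t$ take $w_{t,k}\in\operatorname{argmin}_{z\in\mathcal X}\langle z,v_{t,k}\rangle$ (chosen measurably and without knowledge of later samples) and $x_{t,k+1}=x_{t,k}+\gamma_{t,k}(w_{t,k}-x_{t,k})$; finally $x_{t+1,1}=x_{t,K_t+1}$. Two settings are considered. * *Finite sum:* $P$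 is uniform on $\{1,\dots,n\}$, $n\ge1$, and $Q_t=\{1,\dots,n\}$ is the full index set. * *Expectation:* $P$ is arbitrary, $\mathbb E\|\nabla f(x,\xi)-\nabla f(x)\|^2\le\sigma_f^2$ for all $x\in\mathcal X$, and $Q_t$ consists of $\lceil 2K_t/\beta_{t,1}^2\rceil$ fresh i.i.d. samples of $P$. **Statement.** An optimal dual variable $\lambda^*\in L^2(P;\mathbb R^m)$ of the constraint exists. For every such $\lambda^*$ there is a constant $C$, depending only on $L_f$, $L_A$, $D$, $\beta_0$, $S_{\beta_0}(x_{1,1})$, $\|\lambda^*\|$ and, in the expectation setting, $\sigma_f$ (in particular not on $d$, $m$ or $n$), such that in both settings, for all $t\ge1$ and $1\le k\le K_t$, $$\mathbb E\,|f(x_{t,k})-f(x^*)|\le\frac{C}{\sqrt{K_t+k}},\qquad \sqrt{\mathbb E\,\operatorname{dist}(A(\xi)x_{t,k},b(\xi))^2}\le\frac{C}{\sqrt{K_t+k}},$$ where $\xi\sim P$ is independent of $x_{t,k}$. Moreover, for every $0<\varepsilon\le\frac12$ there is a number $T_\varepsilon$ of epochs, depending only on $\varepsilon$ and the quantities above,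 such that all iterates after epoch $T_\varepsilon$ (in particular the output $x_{T_\varepsilon+1,1}$) satisfy both bounds with right-hand side $\varepsilon$, while the first $T_\varepsilon$ epochs use * in the finite-sum setting at most $C\,(n\log_2(\varepsilon^{-2})+\varepsilon^{-4})$ incremental first-order oracle calls and at most $C\varepsilon^{-2}$ linear minimization oracle calls; * in the expectation setting at most $C\varepsilon^{-4}$ stochastic first-order oracle calls and at most $C\varepsilon^{-2}$ linear minimization oracle calls. -/

import Mathlib

open MeasureTheory ProbabilityTheory

noncomputable section

/-- `ℝ^d` with the Euclidean norm. -/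
abbrev Euc (d : ℕ) : Type := EuclideanSpace ℝ (Fin d)

/-- The strong relative interior of a set `S` in a Hilbert space: the points `x ∈ S` such that the
cone `⋃_{r > 0} r (S - x)` is equal to the closed linear span of `S - x`. -/
def strongRelInterior {H : Type*} [NormedAddCommGroup H] [InnerProductSpace ℝ H] (S : Set H) :
    Set H :=
  {x | x ∈ S ∧ {z | ∃ r : ℝ, 0 < r ∧ ∃ y ∈ S, z = r • (y - x)} =
    closure (Submodule.span ℝ ((fun y => y - x) '' S) : Set H)}

/-- A random closed convex set in `ℝ^m`: nonempty closed convex values, and measurable in the usual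
(Effros) sense that every open set is hit on a measurable event. -/
structure IsRandomClosedConvexSet {m : ℕ} {Ω : Type*} [MeasurableSpace Ω] (b : Ω → Set (Euc m)) :
    Prop where
  nonempty : ∀ ξ, (b ξ).Nonempty
  isClosed : ∀ ξ, IsClosed (b ξ)
  convex : ∀ ξ, Convex ℝ (b ξ)
  measurable : ∀ U : Set (Euc m), IsOpen U → MeasurableSet {ξ | (b ξ ∩ U).Nonempty}

/-- The data of the problem: minimize `E[f(x, ξ)]` over `x ∈ X` subject to `A(ξ) x ∈ b(ξ)` almost
surely, where `ξ` has law `P`. -/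
structure StochProblem (d m : ℕ) (Ω : Type*) [MeasurableSpace Ω] where
  P : Measure Ω
  isProb : IsProbabilityMeasure P
  X : Set (Euc d)
  f : Euc d → Ω → ℝ
  A : Ω → Euc d →L[ℝ] Euc m
  b : Ω → Set (Euc m)

namespace StochProblem

variable {d m : ℕ} {Ω : Type*} [MeasurableSpace Ω] (pb : StochProblem d m Ω)

attribute [instance] StochProblem.isProb

/-- The gradient in `x` of `f(x, ξ)`. -/
def gradf (x : Euc d) (ξ : Ω) : Euc d := gradient (fun y => pb.f y ξ) x

/-- The objective `f(x) = E[f(x, ξ)]`. -/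
def obj (x : Euc d) : ℝ := ∫ ξ, pb.f x ξ ∂pb.P

/-- `dist(A(ξ) x, b(ξ))`. -/
def viol (x : Euc d) (ξ : Ω) : ℝ := Metric.infDist (pb.A ξ x) (pb.b ξ)

/-- `F_β(x, ξ) = f(x, ξ) + dist(A(ξ) x, b(ξ))² / (2β)`. -/
def smoothed (β : ℝ) (x : Euc d) (ξ : Ω) : ℝ := pb.f x ξ + 1 / (2 * β) * pb.viol x ξ ^ 2

/-- The gradient in `x` of `F_β(x, ξ)`. -/
def gradSmoothed (β : ℝ) (x : Euc d) (ξ : Ω) : Euc d := gradient (fun y => pb.smoothed β y ξ) x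

/-- The gradient of `F_β(·, ξ)` at `x`, averaged over a batch of samples. -/
def batchGrad (β : ℝ) (x : Euc d) {N : ℕ} (s : Fin N → Ω) : Euc d :=
  (N : ℝ)⁻¹ • ∑ i, pb.gradSmoothed β x (s i)

/-- `x` satisfies `A(ξ) x ∈ b(ξ)` almost surely. -/
def Feasible (x : Euc d) : Prop := ∀ᵐ ξ ∂pb.P, pb.A ξ x ∈ pb.b ξ

/-- `xs` solves the problem. -/
structure IsSolution (xs : Euc d) : Prop where
  mem : xs ∈ pb.X
  feasible : pb.Feasible xs
  optimal : ∀ x ∈ pb.X, pb.Feasible x → pb.obj xs ≤ pb.obj x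

/-- The smoothed gap `S_β(x) = E[F_β(x, ξ)] - f(xs)`. -/
def smoothedGap (xs : Euc d) (β : ℝ) (x : Euc d) : ℝ :=
  ∫ ξ, pb.smoothed β x ξ ∂pb.P - pb.obj xs

/-- The square-integrable selections of `b`, i.e. the effective domain of
`G(y) = E[δ_{b(ξ)}(y(ξ))]` on `L²(P; ℝ^m)`. -/
def selections : Set (Lp (Euc m) 2 pb.P) := {y | ∀ᵐ ξ ∂pb.P, y ξ ∈ pb.b ξ}

/-- The set `dom(G) - A X` in `L²(P; ℝ^m)`, where `(A x)(ξ) = A(ξ) x`. -/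
def constraintDiff : Set (Lp (Euc m) 2 pb.P) :=
  {z | ∃ y ∈ pb.selections, ∃ x ∈ pb.X, ∀ᵐ ξ ∂pb.P, z ξ = y ξ - pb.A ξ x}

/-- `lam ∈ L²(P; ℝ^m)` is an optimal dual variable (a Lagrange multiplier of the constraint
`A(ξ) x ∈ b(ξ)` a.s.): minimizing the Lagrangian `f(x) + E⟨A(ξ) x - y(ξ), lam(ξ)⟩` over `x ∈ X` and
square-integrable selections `y` of `b` gives at least the optimal value. -/
def IsMultiplier (xs : Euc d) (lam : Lp (Euc m) 2 pb.P) : Prop :=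
  ∀ x ∈ pb.X, ∀ y ∈ pb.selections,
    pb.obj xs ≤ pb.obj x + ∫ ξ, inner ℝ (pb.A ξ x - y ξ) (lam ξ) ∂pb.P

/-- The standing assumptions (all except for the bound on the variance of `∇f(x, ξ)`). -/
structure Assumptions (Lf LA D : ℝ) : Prop where
  f_measurable : ∀ x, Measurable (pb.f x)
  f_integrable : ∀ x, Integrable (pb.f x) pb.P
  f_convex : ∀ ξ, ConvexOn ℝ Set.univ (fun x => pb.f x ξ)
  f_differentiable : ∀ ξ, Differentiable ℝ (fun x => pb.f x ξ)
  f_smooth : ∀ ξ x y, ‖pb.gradf x ξ - pb.gradf y ξ‖ ≤ Lf * ‖x - y‖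
  gradf_integrable : ∀ x, Integrable (pb.gradf x) pb.P
  gradf_unbiased : ∀ x, HasGradientAt pb.obj (∫ ξ, pb.gradf x ξ ∂pb.P) x
  X_convex : Convex ℝ pb.X
  X_compact : IsCompact pb.X
  X_diam : Metric.diam pb.X ≤ D
  b_random : IsRandomClosedConvexSet pb.b
  A_measurable : Measurable pb.A
  A_bounded : ∀ ξ, ‖pb.A ξ‖ ^ 2 ≤ LA
  slater : (0 : Lp (Euc m) 2 pb.P) ∈ strongRelInterior pb.constraintDiff

/-- The stochastic gradients `∇f(x, ξ)` have variance at most `σ²`, uniformly on `X`. -/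
def VarianceBound (σ : ℝ) : Prop :=
  ∀ x ∈ pb.X, Integrable (fun ξ => ‖pb.gradf x ξ - gradient pb.obj x‖ ^ 2) pb.P ∧
    ∫ ξ, ‖pb.gradf x ξ - gradient pb.obj x‖ ^ 2 ∂pb.P ≤ σ ^ 2

/-- The random point `Y` is a `δ`-solution: its expected objective suboptimality and its
root-mean-square infeasibility, with `ξ ∼ P` independent of `Y`, are at most `δ`. -/
structure IsApproxSolution (xs : Euc d) {Ω' : Type*} [MeasurableSpace Ω'] (μ : Measure Ω')
    (Y : Ω' → Euc d) (δ : ℝ) : Prop where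
  subopt_integrable : Integrable (fun ω => |pb.obj (Y ω) - pb.obj xs|) μ
  subopt_le : ∫ ω, |pb.obj (Y ω) - pb.obj xs| ∂μ ≤ δ
  infeas_integrable : Integrable (fun p : Ω' × Ω => pb.viol (Y p.1) p.2 ^ 2) (μ.prod pb.P)
  infeas_le : Real.sqrt (∫ p : Ω' × Ω, pb.viol (Y p.1) p.2 ^ 2 ∂(μ.prod pb.P)) ≤ δ

end StochProblem

/-- The length `K_t = 2^(t-1)` of the `t`-th epoch, `t ≥ 1`; also the inner batch size. -/
def epochLen (t : ℕ) : ℕ := 2 ^ (t - 1)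

/-- The step size `γ_{t,k} = 2 / (K_t + k)`. -/
def stepSize (t k : ℕ) : ℝ := 2 / ((epochLen t : ℝ) + k)

/-- The smoothing parameter `β_{t,k} = β₀ / √(K_t + k)`. -/
def smoothPar (β₀ : ℝ) (t k : ℕ) : ℝ := β₀ / Real.sqrt ((epochLen t : ℝ) + k)

/-- The outer batch size `⌈2 K_t / β_{t,1}²⌉` of the expectation setting. -/
def outerBatch (β₀ : ℝ) (t : ℕ) : ℕ := ⌈2 * (epochLen t : ℝ) / smoothPar β₀ t 1 ^ 2⌉₊

/-- `Y` is a batch of `N` i.i.d. samples of `P`, independent of `past`, and known at time `now`. -/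
structure IsFreshBatch {Ω Ω' : Type*} [MeasurableSpace Ω] (past now : MeasurableSpace Ω')
    [mΩ' : MeasurableSpace Ω'] (P : Measure Ω) (μ : Measure Ω') {N : ℕ} (Y : Ω' → Fin N → Ω) :
    Prop where
  measurable : Measurable[now] Y
  law : μ.map Y = Measure.pi (fun _ => P)
  indep : Indep (MeasurableSpace.comap Y inferInstance) past μ

/-- A run of the double-loop algorithm H-SPIDER-FW on the probability space `(Ω', μ)`, with outer
batch sizes `q t` and inner batch sizes `K_t`. Epochs `t` and inner steps `k` are numbered from 1;
step `(t, k)` has the global number `K_t + k`, and `hist (K_t + k)` is what is known after it. The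
answers `w` of the linear minimization oracle may be any minimizers that do not look ahead. The
origin of the outer batches `Q t` is specified separately. -/
structure HSpiderFW {d m : ℕ} {Ω Ω' : Type*} [MeasurableSpace Ω] [mΩ' : MeasurableSpace Ω']
    (pb : StochProblem d m Ω) (μ : Measure Ω') (β₀ : ℝ) (x₁ : Euc d) (q : ℕ → ℕ) where
  /-- the history of the run -/
  hist : Filtration ℕ mΩ'
  /-- the outer batches -/
  Q : (t : ℕ) → Ω' → Fin (q t) → Ω
  /-- the inner batches -/
  S : (t : ℕ) → ℕ → Ω' → Fin (epochLen t) → Ω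
  /-- the iterates -/
  x : ℕ → ℕ → Ω' → Euc d
  /-- the gradient estimators -/
  v : ℕ → ℕ → Ω' → Euc d
  /-- the answers of the linear minimization oracle -/
  w : ℕ → ℕ → Ω' → Euc d
  start_mem : x₁ ∈ pb.X
  x_start : ∀ ω, x 1 1 ω = x₁
  x_epoch : ∀ t, 1 ≤ t → ∀ ω, x (t + 1) 1 ω = x t (epochLen t + 1) ω
  v_outer : ∀ t, 1 ≤ t → ∀ ω, v t 1 ω = pb.batchGrad (smoothPar β₀ t 1) (x t 1 ω) (Q t ω)
  v_inner : ∀ t k, 1 ≤ t → 2 ≤ k → k ≤ epochLen t → ∀ ω,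
    v t k ω = v t (k - 1) ω
      - pb.batchGrad (smoothPar β₀ t (k - 1)) (x t (k - 1) ω) (S t k ω)
      + pb.batchGrad (smoothPar β₀ t k) (x t k ω) (S t k ω)
  w_lmo : ∀ t k, 1 ≤ t → 1 ≤ k → k ≤ epochLen t → ∀ ω,
    w t k ω ∈ pb.X ∧ ∀ z ∈ pb.X, inner ℝ (w t k ω) (v t k ω) ≤ inner ℝ z (v t k ω)
  x_step : ∀ t k, 1 ≤ t → 1 ≤ k → k ≤ epochLen t → ∀ ω,
    x t (k + 1) ω = x t k ω + stepSize t k • (w t k ω - x t k ω)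
  S_fresh : ∀ t k, 1 ≤ t → 2 ≤ k → k ≤ epochLen t →
    IsFreshBatch (hist (epochLen t + k - 1)) (hist (epochLen t + k)) pb.P μ (S t k)
  w_adapted : ∀ t k, 1 ≤ t → 1 ≤ k → k ≤ epochLen t → Measurable[hist (epochLen t + k)] (w t k)

namespace HSpiderFW

variable {d m : ℕ} {Ω Ω' : Type*} [MeasurableSpace Ω] [MeasurableSpace Ω']
  {pb : StochProblem d m Ω} {μ : Measure Ω'} {β₀ : ℝ} {x₁ : Euc d} {q : ℕ → ℕ}

/-- The outer batches are i.i.d. samples, drawn afresh at the start of every epoch. -/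
def SampledOuter (r : HSpiderFW pb μ β₀ x₁ q) : Prop :=
  ∀ t, 1 ≤ t → IsFreshBatch (r.hist (epochLen t)) (r.hist (epochLen t + 1)) pb.P μ (r.Q t)

/-- In a finite-sum problem: every outer batch is the whole index set. -/
def FullOuter {n : ℕ} {pb : StochProblem d m (Fin n)} (r : HSpiderFW pb μ β₀ x₁ (fun _ => n)) :
    Prop :=
  ∀ t, 1 ≤ t → ∀ ω i, r.Q t ω i = i

end HSpiderFW

/-- The number of first-order oracle calls (evaluations of a sampled gradient at a point) in the
first `T` epochs: the first step of an epoch evaluates its batch at one point, each later step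
evaluates its batch at two points. -/
def gradCalls (q : ℕ → ℕ) (T : ℕ) : ℕ :=
  ∑ t ∈ Finset.Icc 1 T, (q t + ∑ _k ∈ Finset.Icc 2 (epochLen t), 2 * epochLen t)

/-- The number of calls of the linear minimization oracle in the first `T` epochs. -/
def lmoCalls (T : ℕ) : ℕ := ∑ t ∈ Finset.Icc 1 T, ∑ _k ∈ Finset.Icc 1 (epochLen t), 1

/-- The quantities that the constants in the rates may depend on. -/
structure RateData where
  /-- the Lipschitz constant of the gradients `∇f(·, ξ)` -/
  Lf : ℝ
  /-- the bound on `‖A(ξ)‖²` -/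
  LA : ℝ
  /-- the diameter of `X` -/
  D : ℝ
  /-- the initial smoothing parameter -/
  β₀ : ℝ
  /-- the smoothed gap of the initial point at the initial smoothing parameter -/
  gap : ℝ
  /-- the norm of the multiplier -/
  lamNorm : ℝ

end

/-! The almost sure constraint is replaced by the penalty dist²/(2β), and the expected smoothed gap
S_β is followed along the run. Write n = K_t + k. Since K_{t+1} = 2 K_t, the last iterate of an
epoch and the first of the next carry the same n, so the double loop is a single sequence with step
2/n and parameter β₀/√n.

A conditional-gradient step (`smoothedGap_step_le`) contracts S_β by 1 - γ, up to a curvature term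
of order γ²/β and the gradient error times γD. It also leaves a surplus -γ/(2β) E dist², because the
obtuse-angle property of projections, tested at A x*, is stronger than convexity of dist². The
surplus pays for the decrease of β (`smoothedGap_change_le`). If the mean gradient error is O(1/√n),
induction gives a gap O(1/√n) (`recursion_step_le`, `integral_smoothedGap_le`).

For the gradient error, the increment of a sampled smoothed gradient between consecutive steps is
almost surely O(1/√K_t) (`drift_le`): the iterate moves by O(1/n) while the Lipschitz constant is
O(√n), and 1/β changes by O(1/√n). A fresh batch of K_t samples therefore adds O(1/K_t²) to the mean
squared error. Over at most K_t steps the error stays O(1/K_t), provided that the epoch starts with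
such an error (`OuterAccurate`). Almost sure boundedness comes from feasibility of x*, which gives
dist(A x, b) ≤ √LA D on X.

A small gap alone does not exclude an objective far below f(x*). A multiplier does: testing it with
the projection of A x onto b gives f(x) - f(x*) ≥ -‖λ‖δ, where δ is the root-mean-square violation
(`neg_norm_mul_sqrt_le`). Hence δ² ≤ 4βS_β + 4β²‖λ‖², which is O(1/n) in mean, and then |f - f*| is
O(1/√n) in mean. The multiplier exists by Hahn–Banach separation in the closed span of dom G - AX,
where Baire's theorem turns Slater's condition into an interior point
(`exists_lagrange_multiplier`). The oracle counts are geometric sums with 2^T of order ε⁻². -/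

noncomputable section

/-! ### Projection onto a closed convex set and the gradient of the squared distance -/

section NearestPoint

variable {E : Type*} [NormedAddCommGroup E] [InnerProductSpace ℝ E]

open Classical in
/-- A nearest point of `C` to `p`, if there is one. -/
def nearestPoint (C : Set E) (p : E) : E :=
  if h : ∃ q ∈ C, Metric.infDist p C = dist p q then h.choose else p

variable [ProperSpace E] {C : Set E}

omit [InnerProductSpace ℝ E] in
theorem nearestPoint_mem (hc : IsClosed C) (hn : C.Nonempty) (p : E) : nearestPoint C p ∈ C := by
  have h := hc.exists_infDist_eq_dist hn p
  rw [nearestPoint, dif_pos h]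
  exact h.choose_spec.1

omit [InnerProductSpace ℝ E] in
theorem norm_sub_nearestPoint (hc : IsClosed C) (hn : C.Nonempty) (p : E) :
    ‖p - nearestPoint C p‖ = Metric.infDist p C := by
  have h := hc.exists_infDist_eq_dist hn p
  rw [nearestPoint, dif_pos h, ← dist_eq_norm]
  exact h.choose_spec.2.symm

theorem inner_sub_nearestPoint_le_zero (hc : IsClosed C) (hn : C.Nonempty) (hv : Convex ℝ C)
    (p : E) {q : E} (hq : q ∈ C) :
    inner ℝ (p - nearestPoint C p) (q - nearestPoint C p) ≤ 0 := by
  refine (norm_eq_iInf_iff_real_inner_le_zero hv (nearestPoint_mem hc hn p)).1 ?_ q hq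
  rw [norm_sub_nearestPoint hc hn, Metric.infDist_eq_iInf]
  simp only [dist_eq_norm]

/-- The projection of `p` is a competitor for the distance from `p + h`; no convexity is needed. -/
theorem infDist_sq_add_le (hc : IsClosed C) (hn : C.Nonempty) (p h : E) :
    Metric.infDist (p + h) C ^ 2 ≤
      Metric.infDist p C ^ 2 + 2 * inner ℝ (p - nearestPoint C p) h + ‖h‖ ^ 2 := by
  have h1 : Metric.infDist (p + h) C ≤ ‖(p - nearestPoint C p) + h‖ := by
    have := Metric.infDist_le_dist_of_mem (x := p + h) (nearestPoint_mem hc hn p)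
    rwa [dist_eq_norm, add_sub_right_comm] at this
  calc Metric.infDist (p + h) C ^ 2 ≤ ‖(p - nearestPoint C p) + h‖ ^ 2 := by
        gcongr
        exact Metric.infDist_nonneg
    _ = _ := by rw [norm_add_sq_real, norm_sub_nearestPoint hc hn]

/-- With residuals u at `p` and u' at `p + h`, the obtuse-angle inequality gives ⟨u, h⟩ + ‖u‖² ≤ ⟨u,
u'⟩, and the right side is at most (‖u‖² + ‖u'‖²)/2. -/
theorem le_infDist_sq_add (hc : IsClosed C) (hn : C.Nonempty) (hv : Convex ℝ C) (p h : E) :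
    Metric.infDist p C ^ 2 + 2 * inner ℝ (p - nearestPoint C p) h ≤
      Metric.infDist (p + h) C ^ 2 := by
  have h1 := inner_sub_nearestPoint_le_zero hc hn hv p (nearestPoint_mem hc hn (p + h))
  rw [← norm_sub_nearestPoint hc hn p, ← norm_sub_nearestPoint hc hn (p + h)]
  set q := nearestPoint C p
  set q' := nearestPoint C (p + h)
  have h2 := real_inner_le_norm (p - q) (p + h - q')
  have h3 : inner ℝ (p - q) (p + h - q') =
      inner ℝ (p - q) h + ‖p - q‖ ^ 2 - inner ℝ (p - q) (q' - q) := by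
    rw [← real_inner_self_eq_norm_sq, ← inner_add_right, ← inner_sub_right]
    congr 1
    abel
  nlinarith [sq_nonneg (‖p - q‖ - ‖p + h - q'‖)]

/-- The two preceding estimates pin the first-order remainder between 0 and ‖h‖². -/
theorem hasGradientAt_infDist_sq [CompleteSpace E] (hc : IsClosed C) (hn : C.Nonempty)
    (hv : Convex ℝ C) (p : E) :
    HasGradientAt (fun y => Metric.infDist y C ^ 2) ((2 : ℝ) • (p - nearestPoint C p)) p := by
  rw [hasGradientAt_iff_isLittleO_nhds_zero]
  refine Asymptotics.IsBigO.trans_isLittleO (g := fun h : E => ‖h‖ ^ 2) ?_ ?_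
  · refine Asymptotics.isBigO_of_le _ fun h => ?_
    have h1 := infDist_sq_add_le hc hn p h
    have h2 := le_infDist_sq_add hc hn hv p h
    rw [real_inner_smul_left, Real.norm_eq_abs, norm_pow, norm_norm, abs_le]
    constructor <;> linarith [sq_nonneg ‖h‖]
  · simpa using (Asymptotics.isLittleO_norm_pow_id (E' := E) (n := 2) (by norm_num))

/-- Adding the obtuse-angle inequalities at both points shows that the residual map is firmly
nonexpansive; Cauchy–Schwarz then gives nonexpansiveness. -/
theorem norm_residual_sub_le (hc : IsClosed C) (hn : C.Nonempty) (hv : Convex ℝ C) (p p' : E) :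
    ‖(p - nearestPoint C p) - (p' - nearestPoint C p')‖ ≤ ‖p - p'‖ := by
  have h1 := inner_sub_nearestPoint_le_zero hc hn hv p (nearestPoint_mem hc hn p')
  have h2 := inner_sub_nearestPoint_le_zero hc hn hv p' (nearestPoint_mem hc hn p)
  set q := nearestPoint C p
  set q' := nearestPoint C p'
  have h3 : ‖(p - q) - (p' - q')‖ ^ 2 + -(inner ℝ (p - q) (q' - q) + inner ℝ (p' - q') (q - q')) =
      inner ℝ ((p - q) - (p' - q')) (p - p') := by
    have h5 : p - p' = ((p - q) - (p' - q')) - (q' - q) := by abel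
    rw [h5, inner_sub_right ((p - q) - (p' - q')) ((p - q) - (p' - q')) (q' - q), real_inner_self_eq_norm_sq,
      inner_sub_left (p - q) (p' - q') (q' - q),
      show q - q' = -(q' - q) by abel, inner_neg_right]
    ring
  have h4 := real_inner_le_norm ((p - q) - (p' - q')) (p - p')
  by_contra! h
  nlinarith [norm_nonneg (p - p')]

end NearestPoint

/-! ### First-order inequalities for smooth convex functions -/

section FirstOrder

variable {E : Type*} [NormedAddCommGroup E] [InnerProductSpace ℝ E] [CompleteSpace E]

theorem ConvexOn.add_inner_gradient_le {f : E → ℝ} (hf : ConvexOn ℝ Set.univ f) {x g : E}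
    (hg : HasGradientAt f g x) (y : E) : f x + inner ℝ g (y - x) ≤ f y := by
  have hl : HasDerivAt (fun s : ℝ => x + s • (y - x)) (y - x) 0 := by
    simpa using ((hasDerivAt_id (0 : ℝ)).smul_const (y - x)).const_add x
  have hg' : HasFDerivAt f (InnerProductSpace.toDual ℝ E g) (x + (0 : ℝ) • (y - x)) := by
    simpa using hg.hasFDerivAt
  have hd : HasDerivAt (fun s : ℝ => f (x + s • (y - x))) (inner ℝ g (y - x)) 0 := by
    simpa [Function.comp_def] using hg'.comp_hasDerivAt (0 : ℝ) hl
  have hc : ConvexOn ℝ Set.univ (fun s : ℝ => f (x + s • (y - x))) := by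
    have := hf.comp_affineMap (AffineMap.lineMap x y : ℝ →ᵃ[ℝ] E)
    simpa [Function.comp_def, AffineMap.lineMap_apply, add_comm] using this
  have := hc.le_slope_of_hasDerivAt (Set.mem_univ 0) (Set.mem_univ 1) one_pos hd
  simp [slope_def_field] at this
  simpa [add_comm] using add_le_of_le_sub_left this

/-- Convexity is used at `y`, and the gradient there is compared with the one at `x`. This avoids
integrating along the segment, at the price of L in place of L/2. -/
theorem ConvexOn.le_add_inner_gradient_add {f : E → ℝ} (hf : ConvexOn ℝ Set.univ f) {L : ℝ}
    {g : E → E} (hg : ∀ x, HasGradientAt f (g x) x)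
    (hL : ∀ x y, ‖g x - g y‖ ≤ L * ‖x - y‖) (x y : E) :
    f y ≤ f x + inner ℝ (g x) (y - x) + L * ‖y - x‖ ^ 2 := by
  have h1 := hf.add_inner_gradient_le (hg y) x
  have h2 := real_inner_le_norm (g y - g x) (y - x)
  have h3 : inner ℝ (g y) (x - y) = -(inner ℝ (g y - g x) (y - x)) - inner ℝ (g x) (y - x) := by
    rw [inner_sub_left, ← neg_sub y x, inner_neg_right]
    ring
  have h4 := mul_le_mul_of_nonneg_right (hL y x) (norm_nonneg (y - x))
  nlinarith

/-- The gradient of a family of functions is measurable in the parameter. -/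
theorem measurable_of_hasGradientAt {d : ℕ} {Ω : Type*} [MeasurableSpace Ω] {F : Euc d → Ω → ℝ}
    (hF : ∀ x, Measurable (F x)) {x : Euc d} {g : Ω → Euc d}
    (hg : ∀ ξ, HasGradientAt (fun y => F y ξ) (g ξ) x) : Measurable g := by
  have h1 : ∀ i, Measurable fun ξ => g ξ i := by
    intro i
    -- Each partial derivative is a pointwise limit of difference quotients with increment 1/n.
    refine measurable_of_tendsto_metrizable (f := fun (n : ℕ) ξ =>
      (n : ℝ) • (F (x + (n : ℝ)⁻¹ • EuclideanSpace.single i 1) ξ - F x ξ))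
      (fun n => ((hF _).sub (hF _)).const_smul (n : ℝ)) ?_
    rw [tendsto_pi_nhds]
    intro ξ
    have h2 := ((hg ξ).hasFDerivAt.lim_real (EuclideanSpace.single i 1)).comp
      tendsto_natCast_atTop_atTop
    simpa [Function.comp_def, EuclideanSpace.inner_single_right] using h2
  exact (MeasurableEquiv.toLp 2 (Fin d → ℝ)).measurable.comp (measurable_pi_lambda _ h1)

end FirstOrder

/-! ### Measurability, integrability and the one-step inequality for the smoothed problem -/

namespace StochProblem

variable {d m : ℕ} {Ω : Type*} [MeasurableSpace Ω] (pb : StochProblem d m Ω)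

/-- The residual `A(ξ) x - proj_{b(ξ)}(A(ξ) x)` of the constraint. -/
def residual (x : Euc d) (ξ : Ω) : Euc m := pb.A ξ x - nearestPoint (pb.b ξ) (pb.A ξ x)

/-- The mean squared infeasibility of `x`. -/
def meanSqViol (x : Euc d) : ℝ := ∫ ξ, pb.viol x ξ ^ 2 ∂pb.P

/-- The expectation of the gradient of `F_β(x, ξ)`. -/
def meanGrad (β : ℝ) (x : Euc d) : Euc d := ∫ ξ, pb.gradSmoothed β x ξ ∂pb.P

variable {pb} {Lf LA D : ℝ}

theorem viol_nonneg (x : Euc d) (ξ : Ω) : 0 ≤ pb.viol x ξ := Metric.infDist_nonneg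

theorem meanSqViol_nonneg (x : Euc d) : 0 ≤ pb.meanSqViol x :=
  integral_nonneg fun _ => sq_nonneg _

namespace Assumptions

variable (h : pb.Assumptions Lf LA D)
include h

theorem norm_residual (x : Euc d) (ξ : Ω) : ‖pb.residual x ξ‖ = pb.viol x ξ :=
  norm_sub_nearestPoint (h.b_random.isClosed ξ) (h.b_random.nonempty ξ) _

theorem hasGradientAt_f (x : Euc d) (ξ : Ω) :
    HasGradientAt (fun y => pb.f y ξ) (pb.gradf x ξ) x :=
  (h.f_differentiable ξ x).hasGradientAt

theorem norm_A_le (ξ : Ω) : ‖pb.A ξ‖ ≤ √LA := Real.le_sqrt_of_sq_le (h.A_bounded ξ)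

theorem LA_nonneg : 0 ≤ LA := by
  obtain ⟨ξ⟩ := nonempty_of_isProbabilityMeasure pb.P
  exact (sq_nonneg _).trans (h.A_bounded ξ)

theorem D_nonneg : 0 ≤ D := Metric.diam_nonneg.trans h.X_diam

theorem norm_A_apply_le (ξ : Ω) (x : Euc d) : ‖pb.A ξ x‖ ≤ √LA * ‖x‖ :=
  (pb.A ξ).le_of_opNorm_le (h.norm_A_le ξ) x

theorem norm_adjoint_A_apply_le (ξ : Ω) (y : Euc m) :
    ‖ContinuousLinearMap.adjoint (pb.A ξ) y‖ ≤ √LA * ‖y‖ :=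
  ContinuousLinearMap.le_of_opNorm_le _
    ((ContinuousLinearMap.adjoint.norm_map (pb.A ξ)).trans_le (h.norm_A_le ξ)) y

theorem norm_sub_le {x y : Euc d} (hx : x ∈ pb.X) (hy : y ∈ pb.X) : ‖x - y‖ ≤ D := by
  rw [← dist_eq_norm]
  exact (Metric.dist_le_diam_of_mem h.X_compact.isBounded hx hy).trans h.X_diam

theorem hasGradientAt_viol_sq (x : Euc d) (ξ : Ω) :
    HasGradientAt (fun y => pb.viol y ξ ^ 2)
      ((2 : ℝ) • ContinuousLinearMap.adjoint (pb.A ξ) (pb.residual x ξ)) x := by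
  have h1 := (hasGradientAt_infDist_sq (h.b_random.isClosed ξ) (h.b_random.nonempty ξ)
    (h.b_random.convex ξ) (pb.A ξ x)).hasFDerivAt
  have h2 := h1.comp x (pb.A ξ).hasFDerivAt
  refine h2.congr_fderiv ?_
  ext z
  simp [ContinuousLinearMap.adjoint_inner_left, residual]

theorem hasGradientAt_smoothed (β : ℝ) (x : Euc d) (ξ : Ω) :
    HasGradientAt (fun y => pb.smoothed β y ξ)
      (pb.gradf x ξ + β⁻¹ • ContinuousLinearMap.adjoint (pb.A ξ) (pb.residual x ξ)) x := by
  have h1 := (h.hasGradientAt_f x ξ).hasFDerivAt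
  have h2 := (h.hasGradientAt_viol_sq x ξ).hasFDerivAt
  have h3 := h1.add (h2.const_mul (1 / (2 * β)))
  refine h3.congr_fderiv ?_
  ext z
  simp
  ring

theorem gradSmoothed_eq (β : ℝ) (x : Euc d) (ξ : Ω) :
    pb.gradSmoothed β x ξ =
      pb.gradf x ξ + β⁻¹ • ContinuousLinearMap.adjoint (pb.A ξ) (pb.residual x ξ) :=
  (h.hasGradientAt_smoothed β x ξ).gradient

/-- No sign of `Lf` is assumed; passing to |Lf| keeps all later constants nonnegative. -/
theorem norm_gradf_sub_le (x y : Euc d) (ξ : Ω) :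
    ‖pb.gradf x ξ - pb.gradf y ξ‖ ≤ |Lf| * ‖x - y‖ :=
  (h.f_smooth ξ x y).trans (mul_le_mul_of_nonneg_right (le_abs_self _) (norm_nonneg _))

theorem norm_residual_sub_le (x y : Euc d) (ξ : Ω) :
    ‖pb.residual x ξ - pb.residual y ξ‖ ≤ √LA * ‖x - y‖ := by
  refine (_root_.norm_residual_sub_le (h.b_random.isClosed ξ) (h.b_random.nonempty ξ)
    (h.b_random.convex ξ) (pb.A ξ x) (pb.A ξ y)).trans ?_
  rw [← map_sub]
  exact h.norm_A_apply_le ξ _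

theorem continuous_gradf (ξ : Ω) : Continuous fun x => pb.gradf x ξ :=
  (LipschitzWith.of_dist_le_mul (K := ⟨|Lf|, abs_nonneg _⟩) fun x y => by
    rw [dist_eq_norm, dist_eq_norm]
    exact h.norm_gradf_sub_le x y ξ).continuous

theorem continuous_residual (ξ : Ω) : Continuous fun x => pb.residual x ξ :=
  (LipschitzWith.of_dist_le_mul (K := ⟨√LA, Real.sqrt_nonneg _⟩) fun x y => by
    rw [dist_eq_norm, dist_eq_norm]
    exact h.norm_residual_sub_le x y ξ).continuous

omit h in
theorem continuous_viol (ξ : Ω) : Continuous fun x => pb.viol x ξ :=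
  (Metric.continuous_infDist_pt _).comp (pb.A ξ).continuous

theorem continuous_gradSmoothed (β : ℝ) (ξ : Ω) : Continuous fun x => pb.gradSmoothed β x ξ := by
  simp only [h.gradSmoothed_eq]
  have h1 := (ContinuousLinearMap.adjoint (pb.A ξ)).continuous.comp (h.continuous_residual ξ)
  exact (h.continuous_gradf ξ).add (h1.const_smul β⁻¹)

/-- The distance is below `r` exactly when the random set hits an open ball, which is where Effros
measurability enters. -/
theorem measurable_infDist_b (p : Euc m) : Measurable fun ξ => Metric.infDist p (pb.b ξ) := by
  refine measurable_of_Iio fun r => ?_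
  have h1 : (fun ξ => Metric.infDist p (pb.b ξ)) ⁻¹' Set.Iio r =
      {ξ | (pb.b ξ ∩ Metric.ball p r).Nonempty} := by
    ext ξ
    simp only [Set.mem_preimage, Set.mem_Iio, Metric.infDist_lt_iff (h.b_random.nonempty ξ)]
    simp [Set.Nonempty, dist_comm]
  rw [h1]
  exact h.b_random.measurable _ Metric.isOpen_ball

theorem measurable_A_apply (x : Euc d) : Measurable fun ξ => pb.A ξ x :=
  h.A_measurable.apply_continuousLinearMap x

theorem measurable_viol (x : Euc d) : Measurable (pb.viol x) := by
  have h1 : Measurable (Function.uncurry fun (p : Euc m) ξ => Metric.infDist p (pb.b ξ)) :=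
    measurable_uncurry_of_continuous_of_measurable
      (fun ξ => Metric.continuous_infDist_pt (pb.b ξ)) (fun p => h.measurable_infDist_b p)
  have h2 := h1.comp ((h.measurable_A_apply x).prodMk measurable_id)
  simp only [Function.comp_def, Function.uncurry, id] at h2
  exact h2

theorem measurable_uncurry_viol : Measurable fun p : Euc d × Ω => pb.viol p.1 p.2 :=
  measurable_uncurry_of_continuous_of_measurable continuous_viol h.measurable_viol

theorem measurable_gradf (x : Euc d) : Measurable (pb.gradf x) :=
  measurable_of_hasGradientAt h.f_measurable (h.hasGradientAt_f x)

theorem measurable_gradSmoothed (β : ℝ) (x : Euc d) : Measurable (pb.gradSmoothed β x) :=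
  measurable_of_hasGradientAt (F := pb.smoothed β)
    (fun y => (h.f_measurable y).add (((h.measurable_viol y).pow_const 2).const_mul _))
    (fun ξ => (h.gradSmoothed_eq β x ξ) ▸ h.hasGradientAt_smoothed β x ξ)

theorem measurable_uncurry_gradSmoothed (β : ℝ) :
    Measurable fun p : Euc d × Ω => pb.gradSmoothed β p.1 p.2 :=
  measurable_uncurry_of_continuous_of_measurable (h.continuous_gradSmoothed β)
    (h.measurable_gradSmoothed β)

theorem measurable_residual (x : Euc d) : Measurable (pb.residual x) := by
  have h1 : Measurable (Function.uncurry fun (p : Euc m) ξ => p - nearestPoint (pb.b ξ) p) := by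
    refine measurable_uncurry_of_continuous_of_measurable (fun ξ => ?_) fun p => ?_
    · exact (LipschitzWith.of_dist_le_mul (K := 1) fun p q => by
        simpa [dist_eq_norm] using _root_.norm_residual_sub_le (h.b_random.isClosed ξ)
          (h.b_random.nonempty ξ) (h.b_random.convex ξ) p q).continuous
    -- Twice the residual is the gradient of the squared distance, so its measurability in ξ follows
    -- from that of the distance, without a measurable selection argument.
    · have h2 : Measurable fun ξ => (2 : ℝ) • (p - nearestPoint (pb.b ξ) p) :=
        measurable_of_hasGradientAt (F := fun y ξ => Metric.infDist y (pb.b ξ) ^ 2)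
          (fun y => (h.measurable_infDist_b y).pow_const 2) (fun ξ => hasGradientAt_infDist_sq
            (h.b_random.isClosed ξ) (h.b_random.nonempty ξ) (h.b_random.convex ξ) p)
      simpa [Pi.smul_def, smul_smul] using h2.const_smul (2⁻¹ : ℝ)
  change Measurable fun ξ => pb.A ξ x - nearestPoint (pb.b ξ) (pb.A ξ x)
  exact h1.comp ((h.measurable_A_apply x).prodMk measurable_id)

variable {xs : Euc d}

/-- The point A x* lies in b almost surely and is a competitor for the distance. The exceptional
null set does not depend on `x`, so random points can be substituted. -/
theorem viol_le_ae (hs : pb.IsSolution xs) :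
    ∀ᵐ ξ ∂pb.P, ∀ x ∈ pb.X, pb.viol x ξ ≤ √LA * D := by
  filter_upwards [hs.feasible] with ξ hξ x hx
  calc pb.viol x ξ ≤ dist (pb.A ξ x) (pb.A ξ xs) := Metric.infDist_le_dist_of_mem hξ
    _ = ‖pb.A ξ (x - xs)‖ := by rw [dist_eq_norm, map_sub]
    _ ≤ √LA * ‖x - xs‖ := h.norm_A_apply_le ξ _
    _ ≤ √LA * D := by
      gcongr
      exact h.norm_sub_le hx hs.mem

theorem viol_sq_le_ae (hs : pb.IsSolution xs) :
    ∀ᵐ ξ ∂pb.P, ∀ x ∈ pb.X, pb.viol x ξ ^ 2 ≤ LA * D ^ 2 := by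
  filter_upwards [h.viol_le_ae hs] with ξ hξ x hx
  calc pb.viol x ξ ^ 2 ≤ (√LA * D) ^ 2 := by
        gcongr
        · exact viol_nonneg x ξ
        · exact hξ x hx
    _ = LA * D ^ 2 := by rw [mul_pow, Real.sq_sqrt h.LA_nonneg]

theorem integrable_viol_sq (hs : pb.IsSolution xs) {x : Euc d} (hx : x ∈ pb.X) :
    Integrable (fun ξ => pb.viol x ξ ^ 2) pb.P := by
  refine Integrable.of_bound (((h.measurable_viol x).pow_const 2).aestronglyMeasurable)
    (LA * D ^ 2) ?_
  filter_upwards [h.viol_sq_le_ae hs] with ξ hξ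
  rw [Real.norm_eq_abs, abs_of_nonneg (sq_nonneg _)]
  exact hξ x hx

theorem meanSqViol_le (hs : pb.IsSolution xs) {x : Euc d} (hx : x ∈ pb.X) :
    pb.meanSqViol x ≤ LA * D ^ 2 := by
  have h1 := integral_mono_ae (h.integrable_viol_sq hs hx) (integrable_const (LA * D ^ 2))
    (by filter_upwards [h.viol_sq_le_ae hs] with ξ hξ using hξ x hx)
  simpa [meanSqViol] using h1

theorem integrable_adjoint_residual (hs : pb.IsSolution xs) {x : Euc d} (hx : x ∈ pb.X) :
    Integrable (fun ξ => ContinuousLinearMap.adjoint (pb.A ξ) (pb.residual x ξ)) pb.P := by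
  have h1 : (fun ξ => ContinuousLinearMap.adjoint (pb.A ξ) (pb.residual x ξ)) =
      fun ξ => pb.gradSmoothed 1 x ξ - pb.gradf x ξ := by
    ext1 ξ
    simp [h.gradSmoothed_eq]
  refine Integrable.of_bound (C := √LA * (√LA * D)) ?_ ?_
  · rw [h1]
    exact ((h.measurable_gradSmoothed 1 x).sub (h.measurable_gradf x)).aestronglyMeasurable
  · filter_upwards [h.viol_le_ae hs] with ξ hξ
    refine (h.norm_adjoint_A_apply_le ξ _).trans ?_
    rw [h.norm_residual]
    gcongr
    exact hξ x hx

theorem integrable_gradSmoothed (hs : pb.IsSolution xs) (β : ℝ) {x : Euc d} (hx : x ∈ pb.X) :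
    Integrable (pb.gradSmoothed β x) pb.P := by
  have : pb.gradSmoothed β x = fun ξ =>
      pb.gradf x ξ + β⁻¹ • ContinuousLinearMap.adjoint (pb.A ξ) (pb.residual x ξ) :=
    funext fun ξ => h.gradSmoothed_eq β x ξ
  rw [this]
  exact (h.gradf_integrable x).add ((h.integrable_adjoint_residual hs hx).smul β⁻¹)

theorem integrable_inner_residual (hs : pb.IsSolution xs) {x : Euc d} (hx : x ∈ pb.X)
    (z : Euc d) : Integrable (fun ξ => inner ℝ (pb.residual x ξ) (pb.A ξ z)) pb.P := by
  simpa [ContinuousLinearMap.adjoint_inner_left] using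
    (h.integrable_adjoint_residual hs hx).inner_const (𝕜 := ℝ) z

theorem inner_meanGrad (hs : pb.IsSolution xs) (β : ℝ) {x : Euc d} (hx : x ∈ pb.X) (z : Euc d) :
    inner ℝ (pb.meanGrad β x) z = inner ℝ (∫ ξ, pb.gradf x ξ ∂pb.P) z +
      β⁻¹ * ∫ ξ, inner ℝ (pb.residual x ξ) (pb.A ξ z) ∂pb.P := by
  have h1 := h.integrable_adjoint_residual hs hx
  have h2 : ∫ ξ, inner ℝ (pb.residual x ξ) (pb.A ξ z) ∂pb.P =
      inner ℝ (∫ ξ, ContinuousLinearMap.adjoint (pb.A ξ) (pb.residual x ξ) ∂pb.P) z := by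
    rw [real_inner_comm, ← integral_inner h1]
    simp only [ContinuousLinearMap.adjoint_inner_right, real_inner_comm]
  rw [meanGrad, h2]
  simp only [h.gradSmoothed_eq]
  rw [integral_add (h.gradf_integrable x) (by exact h1.smul β⁻¹), integral_smul, inner_add_left,
    real_inner_smul_left]

theorem obj_ge (x y : Euc d) :
    pb.obj x + inner ℝ (∫ ξ, pb.gradf x ξ ∂pb.P) (y - x) ≤ pb.obj y := by
  have h1 := h.gradf_integrable x
  rw [real_inner_comm, ← integral_inner h1, obj, obj,
    ← integral_add (h.f_integrable x) (h1.const_inner _)]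
  refine integral_mono ((h.f_integrable x).add (h1.const_inner _)) (h.f_integrable y) fun ξ => ?_
  rw [real_inner_comm]
  exact (h.f_convex ξ).add_inner_gradient_le (h.hasGradientAt_f x ξ) y

theorem obj_le (x y : Euc d) :
    pb.obj y ≤ pb.obj x + inner ℝ (∫ ξ, pb.gradf x ξ ∂pb.P) (y - x) + |Lf| * ‖y - x‖ ^ 2 := by
  have h1 := h.gradf_integrable x
  have h2 : Integrable (fun ξ => pb.f x ξ + inner ℝ (y - x) (pb.gradf x ξ)) pb.P :=
    (h.f_integrable x).add (h1.const_inner (𝕜 := ℝ) (y - x))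
  have h3 : ∫ ξ, (pb.f x ξ + inner ℝ (y - x) (pb.gradf x ξ)) + |Lf| * ‖y - x‖ ^ 2 ∂pb.P =
      pb.obj x + inner ℝ (∫ ξ, pb.gradf x ξ ∂pb.P) (y - x) + |Lf| * ‖y - x‖ ^ 2 := by
    rw [integral_add h2 (integrable_const _), integral_add (h.f_integrable x) (h1.const_inner _),
      real_inner_comm, ← integral_inner h1]
    simp [obj]
  rw [← h3]
  refine integral_mono (h.f_integrable y) (h2.add (integrable_const _)) fun ξ => ?_
  simp only []
  rw [real_inner_comm]
  exact (h.f_convex ξ).le_add_inner_gradient_add (fun z => h.hasGradientAt_f z ξ)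
    (fun a b => h.norm_gradf_sub_le a b ξ) x y

theorem meanSqViol_le_add (hs : pb.IsSolution xs) {x y : Euc d} (hx : x ∈ pb.X) (hy : y ∈ pb.X) :
    pb.meanSqViol y ≤ pb.meanSqViol x +
      2 * ∫ ξ, inner ℝ (pb.residual x ξ) (pb.A ξ (y - x)) ∂pb.P + LA * ‖y - x‖ ^ 2 := by
  have h1 := h.integrable_viol_sq hs hx
  have h2 := (h.integrable_inner_residual hs hx (y - x)).const_mul 2
  have h6 : Integrable (fun ξ => pb.viol x ξ ^ 2 +
      2 * inner ℝ (pb.residual x ξ) (pb.A ξ (y - x))) pb.P := h1.add h2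
  have h3 : ∫ ξ, (pb.viol x ξ ^ 2 + 2 * inner ℝ (pb.residual x ξ) (pb.A ξ (y - x))) +
      LA * ‖y - x‖ ^ 2 ∂pb.P = pb.meanSqViol x +
      2 * ∫ ξ, inner ℝ (pb.residual x ξ) (pb.A ξ (y - x)) ∂pb.P + LA * ‖y - x‖ ^ 2 := by
    rw [integral_add h6 (integrable_const _), integral_add h1 h2, integral_const_mul]
    simp [meanSqViol]
  rw [← h3]
  refine integral_mono (h.integrable_viol_sq hs hy) (h6.add (integrable_const _))
    fun ξ => ?_
  have h4 := infDist_sq_add_le (h.b_random.isClosed ξ) (h.b_random.nonempty ξ) (pb.A ξ x)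
    (pb.A ξ (y - x))
  rw [← map_add, add_sub_cancel] at h4
  have h5 : ‖pb.A ξ (y - x)‖ ^ 2 ≤ LA * ‖y - x‖ ^ 2 := by
    rw [← Real.sq_sqrt h.LA_nonneg, ← mul_pow]
    gcongr
    exact h.norm_A_apply_le ξ _
  exact h4.trans (add_le_add le_rfl h5)

/-- Convexity of the squared distance would only give half of this bound. The obtuse-angle
inequality at A x* gives the full -E dist², and the extra half becomes the surplus in the step
inequality. -/
theorem integral_inner_residual_le (hs : pb.IsSolution xs) {x : Euc d} (hx : x ∈ pb.X) :
    ∫ ξ, inner ℝ (pb.residual x ξ) (pb.A ξ (xs - x)) ∂pb.P ≤ -pb.meanSqViol x := by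
  rw [meanSqViol, ← integral_neg]
  refine integral_mono_ae (h.integrable_inner_residual hs hx _) (h.integrable_viol_sq hs hx).neg ?_
  filter_upwards [hs.feasible] with ξ hξ
  have h1 := inner_sub_nearestPoint_le_zero (h.b_random.isClosed ξ) (h.b_random.nonempty ξ)
    (h.b_random.convex ξ) (pb.A ξ x) hξ
  have h2 : pb.A ξ (xs - x) = (pb.A ξ xs - nearestPoint (pb.b ξ) (pb.A ξ x)) - pb.residual x ξ := by
    rw [residual, map_sub]
    abel
  rw [h2, inner_sub_right, real_inner_self_eq_norm_sq, h.norm_residual]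
  rw [residual]
  linarith

theorem smoothedGap_eq (hs : pb.IsSolution xs) (β : ℝ) {x : Euc d} (hx : x ∈ pb.X) :
    pb.smoothedGap xs β x = pb.obj x - pb.obj xs + 1 / (2 * β) * pb.meanSqViol x := by
  rw [smoothedGap]
  simp only [smoothed]
  rw [integral_add (h.f_integrable x) ((h.integrable_viol_sq hs hx).const_mul _),
    integral_const_mul, obj, meanSqViol, obj]
  ring

theorem continuous_obj : Continuous pb.obj :=
  continuous_iff_continuousAt.2 fun x => (h.gradf_unbiased x).hasFDerivAt.continuousAt

/-- One conditional-gradient step with an inexact gradient `v`. -/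
theorem smoothedGap_step_le (hs : pb.IsSolution xs) {β γ : ℝ} (hβ : 0 < β) (hγ : 0 ≤ γ)
    (hγ1 : γ ≤ 1) {x w v : Euc d} (hx : x ∈ pb.X) (hw : w ∈ pb.X)
    (hmin : ∀ z ∈ pb.X, inner ℝ w v ≤ inner ℝ z v) :
    pb.smoothedGap xs β (x + γ • (w - x)) ≤ (1 - γ) * pb.smoothedGap xs β x -
      γ / (2 * β) * pb.meanSqViol x + γ * D * ‖v - pb.meanGrad β x‖ +
      γ ^ 2 * D ^ 2 * (|Lf| + LA / (2 * β)) := by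
  set y := x + γ • (w - x)
  have hyx : y - x = γ • (w - x) := by simp [y]
  have hy : y ∈ pb.X := h.X_convex.add_smul_sub_mem hx hw ⟨hγ, hγ1⟩
  rw [h.smoothedGap_eq hs β hx, h.smoothedGap_eq hs β hy]
  have h1 := h.obj_le x y
  have h2 := h.meanSqViol_le_add hs hx hy
  have h3 := h.inner_meanGrad hs β hx (y - x)
  have h4 := h.inner_meanGrad hs β hx (xs - x)
  have h5 := h.obj_ge x xs
  have h6 := h.integral_inner_residual_le hs hx
  -- The oracle answer beats x* for `v`; passing to the true gradient costs ⟨v - ∇, x* - w⟩, hence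
  -- at most `D` times the error.
  have h7 : inner ℝ (pb.meanGrad β x) (y - x) ≤
      γ * (inner ℝ (pb.meanGrad β x) (xs - x) + D * ‖v - pb.meanGrad β x‖) := by
    rw [hyx, real_inner_smul_right]
    gcongr
    have h8 := hmin xs hs.mem
    have h9 := real_inner_le_norm (v - pb.meanGrad β x) (xs - w)
    have h10 : ‖v - pb.meanGrad β x‖ * ‖xs - w‖ ≤ ‖v - pb.meanGrad β x‖ * D := by
      gcongr
      exact h.norm_sub_le hs.mem hw
    have h11 : inner ℝ (pb.meanGrad β x) (w - x) =
        inner ℝ (pb.meanGrad β x) (xs - x) + inner ℝ (v - pb.meanGrad β x) (xs - w)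
        + (inner ℝ w v - inner ℝ xs v) := by
      simp only [inner_sub_left, inner_sub_right, real_inner_comm]
      ring
    linarith
  have h8 : ‖y - x‖ ^ 2 ≤ γ ^ 2 * D ^ 2 := by
    rw [hyx, norm_smul, mul_pow, Real.norm_eq_abs, sq_abs]
    gcongr
    exact h.norm_sub_le hw hx
  have h9 : |Lf| * ‖y - x‖ ^ 2 ≤ |Lf| * (γ ^ 2 * D ^ 2) := by gcongr
  have h10 : LA * ‖y - x‖ ^ 2 ≤ LA * (γ ^ 2 * D ^ 2) :=
    mul_le_mul_of_nonneg_left h8 h.LA_nonneg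
  have hβ' : 0 < β⁻¹ := inv_pos.2 hβ
  have e1 : 1 / (2 * β) = β⁻¹ / 2 := by field_simp
  have e2 : γ / (2 * β) = γ * β⁻¹ / 2 := by field_simp
  have e3 : LA / (2 * β) = LA * β⁻¹ / 2 := by field_simp
  rw [e1, e2, e3]
  have h11 := mul_le_mul_of_nonneg_left h2 hβ'.le
  have h12 := mul_le_mul_of_nonneg_left h10 hβ'.le
  have h13 := mul_le_mul_of_nonneg_left h6 hβ'.le
  have h14 := mul_le_mul_of_nonneg_left (add_le_add h5 h13) hγ
  rw [h3] at h7
  rw [h4] at h7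
  nlinarith

end Assumptions

end StochProblem

/-! ### Lagrange multipliers under a strong relative interior condition -/

section ConvexDuality

open scoped Pointwise

/-- A closed convex set in a complete space whose positive multiples cover the space is a
neighbourhood of `0`. -/
theorem zero_mem_interior_of_absorbing {V : Type*} [NormedAddCommGroup V] [NormedSpace ℝ V]
    [CompleteSpace V] {T : Set V} (hc : IsClosed T) (hv : Convex ℝ T) (h0 : (0 : V) ∈ T)
    (ha : ∀ v, ∃ r : ℝ, 0 < r ∧ ∃ y ∈ T, v = r • y) : (0 : V) ∈ interior T := by
  -- Baire: the closed dilates of `T` cover the space, so one of them, and hence `T`, has an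
  -- interior point x.
  have h1 : ∃ n : ℕ, (interior ((fun v : V => ((n : ℝ) + 1)⁻¹ • v) ⁻¹' T)).Nonempty := by
    refine nonempty_interior_of_iUnion_of_closed
      (fun n => hc.preimage (continuous_const_smul _)) (Set.eq_univ_of_forall fun v => ?_)
    obtain ⟨r, hr, y, hy, rfl⟩ := ha v
    obtain ⟨n, hn⟩ := exists_nat_ge r
    refine Set.mem_iUnion.2 ⟨n, ?_⟩
    have hn1 : (0 : ℝ) < n + 1 := by positivity
    rw [Set.mem_preimage, smul_smul]
    refine hv.smul_mem_of_zero_mem h0 hy ⟨by positivity, ?_⟩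
    rw [inv_mul_le_iff₀ hn1]
    linarith
  obtain ⟨n, v, hvn⟩ := h1
  have hn1 : ((n : ℝ) + 1)⁻¹ ≠ 0 := by positivity
  have h2 : ((n : ℝ) + 1)⁻¹ • v ∈ interior T := by
    have h3 := (Homeomorph.smulOfNeZero _ hn1).preimage_interior T (X := V)
    have h4 : v ∈ (Homeomorph.smulOfNeZero _ hn1) ⁻¹' interior T := h3 ▸ hvn
    exact h4
  set x := ((n : ℝ) + 1)⁻¹ • v
  -- Since -x = r y with y in `T`, the origin lies strictly between the interior point x and y.
  obtain ⟨r, hr, y, hy, hxy⟩ := ha (-x)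
  refine hv.openSegment_interior_self_subset_interior h2 hy
    ⟨1 / (1 + r), r / (1 + r), by positivity, by positivity, by field_simp, ?_⟩
  have h5 : (1 / (1 + r)) • x + (r / (1 + r)) • y = (1 / (1 + r)) • (x + r • y) := by
    rw [smul_add, smul_smul (1 / (1 + r)) r y, one_div_mul_eq_div]
  rw [h5, ← hxy, add_neg_cancel, smul_zero]

/-- Existence of a Lagrange multiplier for a convex problem `f(x) → min`, `x ∈ X`, `L x ∈ S`. -/
theorem exists_lagrange_multiplier {E H : Type*} [NormedAddCommGroup E] [NormedSpace ℝ E]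
    [NormedAddCommGroup H] [InnerProductSpace ℝ H] [CompleteSpace H] {X : Set E} {S : Set H}
    (L : E →L[ℝ] H) {f : E → ℝ} {p : ℝ} (hXc : IsCompact X) (hXv : Convex ℝ X)
    (hSc : IsClosed S) (hSv : Convex ℝ S) (hf : ConvexOn ℝ X f) (hfc : ContinuousOn f X)
    (hp : ∀ x ∈ X, L x ∈ S → p ≤ f x)
    (h0 : (0 : H) ∈ strongRelInterior {z | ∃ y ∈ S, ∃ x ∈ X, z = y - L x}) :
    ∃ lam : H, ∀ x ∈ X, ∀ y ∈ S, p ≤ f x + inner ℝ (L x - y) lam := by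
  set T : Set H := {z | ∃ y ∈ S, ∃ x ∈ X, z = y - L x} with hT
  obtain ⟨h0T, hcone⟩ := h0
  simp only [sub_zero, Set.image_id'] at hcone
  have hTS : T = S - L '' X := by
    ext z
    constructor
    · rintro ⟨y, hy, x, hx, rfl⟩
      exact Set.sub_mem_sub hy (Set.mem_image_of_mem L hx)
    · rintro ⟨y, hy, _, ⟨x, hx, rfl⟩, rfl⟩
      exact ⟨y, hy, x, hx, rfl⟩
  have hTc : IsClosed T := by
    rw [hTS, sub_eq_add_neg]
    exact hSc.add_right_of_isCompact (hXc.image L.continuous).neg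
  have hTv : Convex ℝ T := by
    rw [hTS]
    exact hSv.sub (hXv.linear_image L.toLinearMap)
  -- In `H` itself `T` may have empty interior, so the separation takes place in the closed span of
  -- `T`.
  set V : Submodule ℝ H := (Submodule.span ℝ T).topologicalClosure
  have hV : (V : Set H) = closure (Submodule.span ℝ T : Set H) :=
    Submodule.topologicalClosure_coe _
  have hTV : T ⊆ V := fun z hz =>
    Submodule.le_topologicalClosure _ (Submodule.subset_span hz)
  have hVcl : IsClosed (V : Set H) := Submodule.isClosed_topologicalClosure _
  have : CompleteSpace V := hVcl.completeSpace_coe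
  set T' : Set V := (fun v : V => (v : H)) ⁻¹' T
  have h0' : (0 : V) ∈ interior T' := by
    refine zero_mem_interior_of_absorbing (hTc.preimage continuous_subtype_val)
      (hTv.linear_preimage V.subtype) h0T fun v => ?_
    have h1 : (v : H) ∈ closure (Submodule.span ℝ T : Set H) := hV ▸ v.2
    rw [← hcone] at h1
    obtain ⟨r, hr, y, hy, hvy⟩ := h1
    exact ⟨r, hr, ⟨y, hTV hy⟩, hy, Subtype.ext hvy⟩
  obtain ⟨M, hM⟩ := (hXc.image_of_continuousOn hfc).bddAbove
  -- The strict epigraph of the perturbed value function. It misses (0, p), and it contains a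
  -- neighbourhood of 0 times (M, ∞), where `M` bounds `f` on `X`.
  set K : Set (V × ℝ) := {q | ∃ y ∈ S, ∃ x ∈ X, (q.1 : H) = y - L x ∧ f x < q.2} with hK
  have hKv : Convex ℝ K := by
    rintro ⟨z₁, r₁⟩ ⟨y₁, hy₁, x₁, hx₁, e₁, l₁⟩ ⟨z₂, r₂⟩ ⟨y₂, hy₂, x₂, hx₂, e₂, l₂⟩ a b ha hb hab
    refine ⟨a • y₁ + b • y₂, hSv hy₁ hy₂ ha hb hab, a • x₁ + b • x₂, hXv hx₁ hx₂ ha hb hab, ?_, ?_⟩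
    · simp only [Prod.fst_add, Prod.smul_fst, Submodule.coe_add, Submodule.coe_smul] at e₁ e₂ ⊢
      rw [e₁, e₂, map_add, map_smul, map_smul, smul_sub, smul_sub]
      abel
    · refine (hf.2 hx₁ hx₂ ha hb hab).trans_lt ?_
      simp only [Prod.snd_add, Prod.smul_snd, smul_eq_mul] at l₁ l₂ ⊢
      rcases ha.eq_or_lt with rfl | ha'
      · have : b = 1 := by linarith
        subst this
        simpa using l₂
      · nlinarith [mul_lt_mul_of_pos_left l₁ ha', mul_le_mul_of_nonneg_left l₂.le hb]
  have hint : interior T' ×ˢ Set.Ioi M ⊆ interior K := by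
    refine interior_maximal ?_ (isOpen_interior.prod isOpen_Ioi)
    rintro ⟨z, r⟩ ⟨hz, hr⟩
    obtain ⟨y, hy, x, hx, e⟩ := interior_subset hz
    exact ⟨y, hy, x, hx, e, (hM ⟨x, hx, rfl⟩).trans_lt hr⟩
  have hnot : ((0 : V), p) ∉ interior K := by
    intro hmem
    obtain ⟨y, hy, x, hx, e, l⟩ := interior_subset hmem
    have : L x = y := (sub_eq_zero.1 e.symm).symm
    exact (hp x hx (this ▸ hy)).not_gt l
  obtain ⟨g, hg⟩ := geometric_hahn_banach_open_point hKv.interior isOpen_interior hnot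
  have hR : ((0 : V), max M p + 1) ∈ interior K :=
    hint ⟨h0', (le_max_left M p).trans_lt (lt_add_one _)⟩
  have hsplit : ∀ (z : V) (r : ℝ), g (z, r) = g (z, 0) + r * g (0, 1) := by
    intro z r
    have : ((z, r) : V × ℝ) = (z, 0) + r • (0, 1) := by simp
    rw [this, map_add, map_smul, smul_eq_mul]
  -- The separating hyperplane is not vertical, because an interior point of `K` lies straight above
  -- (0, p).
  have hc : g (0, 1) < 0 := by
    have h1 := hg _ hR
    rw [hsplit, hsplit 0 p] at h1
    have h2 : p < max M p + 1 := (le_max_right M p).trans_lt (lt_add_one _)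
    nlinarith
  have hle : ∀ q ∈ K, g q ≤ g (0, p) := by
    intro q hq
    have h1 : closure (interior K) ⊆ {q | g q ≤ g (0, p)} :=
      closure_minimal (fun a ha => (hg a ha).le) (isClosed_le g.continuous continuous_const)
    rw [hKv.closure_interior_eq_closure_of_nonempty_interior ⟨_, hR⟩] at h1
    exact h1 (subset_closure hq)
  set φ : V →L[ℝ] ℝ := (g (0, 1))⁻¹ • (g.comp (ContinuousLinearMap.inl ℝ V ℝ)) with hφ
  set u : V := (InnerProductSpace.toDual ℝ V).symm φ
  refine ⟨-(u : H), fun x hx y hy => ?_⟩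
  set z : V := ⟨y - L x, hTV ⟨y, hy, x, hx, rfl⟩⟩ with hz
  have h1 : g (z, 0) + f x * g (0, 1) ≤ p * g (0, 1) := by
    -- The strict inequality in `K` forces a slack above `f x`, which is sent to 0.
    refine le_of_forall_pos_le_add fun η hη => ?_
    have h2 := hle (z, f x + η / (-g (0, 1)))
      ⟨y, hy, x, hx, rfl, lt_add_of_pos_right _ (div_pos hη (neg_pos.2 hc))⟩
    rw [hsplit, hsplit 0 p] at h2
    have h3 : η / (-g (0, 1)) * g (0, 1) = -η := by
      have := hc.ne
      field_simp
    have h4 : g ((0 : V), (0 : ℝ)) = 0 := map_zero g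
    rw [add_mul, h3, h4] at h2
    linarith
  have h2 : inner ℝ (L x - y) (-(u : H)) = φ z := by
    have h3 : inner ℝ u z = φ z := InnerProductSpace.toDual_symm_apply
    rw [← h3, Submodule.coe_inner, hz, real_inner_comm, ← neg_sub y (L x), inner_neg_neg]
  have h3 : φ z = (g (0, 1))⁻¹ * g (z, 0) := by simp [hφ]
  rw [h2, h3]
  have h4 := mul_le_mul_of_nonpos_left h1 (inv_nonpos.2 hc.le)
  have h5 : (g (0, 1))⁻¹ * (p * g (0, 1)) = p := by
    have := hc.ne
    field_simp
  have h6 : (g (0, 1))⁻¹ * (f x * g (0, 1)) = f x := by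
    have := hc.ne
    field_simp
  linarith

end ConvexDuality

/-! ### The multiplier of the stochastic problem and its lower bound on the objective -/

namespace StochProblem.Assumptions

variable {d m : ℕ} {Ω : Type*} [MeasurableSpace Ω] {pb : StochProblem d m Ω} {Lf LA D : ℝ}
  {xs : Euc d} (h : pb.Assumptions Lf LA D)
include h

theorem memLp_A_apply (x : Euc d) : MemLp (fun ξ => pb.A ξ x) 2 pb.P :=
  MemLp.of_bound (h.measurable_A_apply x).aestronglyMeasurable (√LA * ‖x‖)
    (ae_of_all _ fun ξ => h.norm_A_apply_le ξ x)

theorem memLp_residual (hs : pb.IsSolution xs) {x : Euc d} (hx : x ∈ pb.X) :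
    MemLp (pb.residual x) 2 pb.P := by
  refine MemLp.of_bound (h.measurable_residual x).aestronglyMeasurable (√LA * D) ?_
  filter_upwards [h.viol_le_ae hs] with ξ hξ
  rw [h.norm_residual]
  exact hξ x hx

/-- The multiplier inequality is tested with the projection of A x onto b as selection. The pairing
is then ⟨residual, λ⟩ in L², and Cauchy–Schwarz applies. -/
theorem neg_norm_mul_sqrt_le (hs : pb.IsSolution xs) {lam : Lp (Euc m) 2 pb.P}
    (hl : pb.IsMultiplier xs lam) {x : Euc d} (hx : x ∈ pb.X) :
    -(‖lam‖ * √(pb.meanSqViol x)) ≤ pb.obj x - pb.obj xs := by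
  have hr := h.memLp_residual hs hx
  have hy := (h.memLp_A_apply x).sub hr
  have h1 : hy.toLp ∈ pb.selections := by
    filter_upwards [hy.coeFn_toLp] with ξ hξ
    rw [hξ]
    simpa [residual] using
      nearestPoint_mem (h.b_random.isClosed ξ) (h.b_random.nonempty ξ) (pb.A ξ x)
  have h2 := hl x hx _ h1
  have h3 : ∫ ξ, inner ℝ (pb.A ξ x - hy.toLp _ ξ) (lam ξ) ∂pb.P = inner ℝ hr.toLp lam := by
    rw [L2.inner_def]
    refine integral_congr_ae ?_
    filter_upwards [hy.coeFn_toLp, hr.coeFn_toLp] with ξ h4 h5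
    rw [h4, h5]
    simp
  have h4 : ‖hr.toLp‖ = √(pb.meanSqViol x) := by
    rw [eq_comm, Real.sqrt_eq_iff_eq_sq (meanSqViol_nonneg x) (norm_nonneg _),
      ← real_inner_self_eq_norm_sq, L2.inner_def]
    refine integral_congr_ae ?_
    filter_upwards [hr.coeFn_toLp] with ξ h5
    rw [h5, real_inner_self_eq_norm_sq, h.norm_residual]
  have h5 := le_of_abs_le (abs_real_inner_le_norm hr.toLp lam)
  rw [h3] at h2
  rw [h4] at h5
  linarith

theorem convexOn_obj : ConvexOn ℝ Set.univ pb.obj := by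
  refine ⟨convex_univ, fun x _ y _ a b ha hb hab => ?_⟩
  have h1 : Integrable (fun ξ => a • pb.f x ξ) pb.P := (h.f_integrable x).smul a
  have h2 : Integrable (fun ξ => b • pb.f y ξ) pb.P := (h.f_integrable y).smul b
  rw [obj, obj, obj, ← integral_smul, ← integral_smul, ← integral_add h1 h2]
  exact integral_mono (h.f_integrable _) (h1.add h2) fun ξ =>
    (h.f_convex ξ).2 (Set.mem_univ x) (Set.mem_univ y) ha hb hab

theorem convex_selections : Convex ℝ pb.selections := by
  intro y hy z hz a b ha hb hab
  filter_upwards [hy, hz, Lp.coeFn_add (a • y) (b • z), Lp.coeFn_smul a y, Lp.coeFn_smul b z]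
    with ξ h1 h2 h3 h4 h5
  rw [h3, Pi.add_apply, h4, h5]
  exact h.b_random.convex ξ h1 h2 ha hb hab

/-- An L²-convergent sequence has an almost everywhere convergent subsequence, and the values of b
are closed. -/
theorem isClosed_selections : IsClosed pb.selections := by
  refine IsSeqClosed.isClosed fun y z hy hz => ?_
  have h1 := tendstoInMeasure_of_tendsto_Lp hz
  obtain ⟨φ, -, hφ⟩ := h1.exists_seq_tendsto_ae
  filter_upwards [hφ, ae_all_iff.2 hy] with ξ h2 h3
  exact (h.b_random.isClosed ξ).mem_of_tendsto h2 (Filter.Eventually.of_forall fun n => h3 (φ n))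

/-- Slater's condition implies that an optimal dual variable exists. -/
theorem exists_isMultiplier (hs : pb.IsSolution xs) : ∃ lam, pb.IsMultiplier xs lam := by
  let L₀ : Euc d →ₗ[ℝ] Lp (Euc m) 2 pb.P :=
    { toFun := fun x => (h.memLp_A_apply x).toLp
      map_add' := fun x y => by
        rw [← MemLp.toLp_add]
        congr 1
        ext1 ξ
        simp
      map_smul' := fun r x => by
        rw [RingHom.id_apply, ← MemLp.toLp_const_smul]
        congr 1
        ext1 ξ
        simp }
  let L := LinearMap.toContinuousLinearMap L₀
  have hL : ∀ x, L x =ᵐ[pb.P] fun ξ => pb.A ξ x := fun x => (h.memLp_A_apply x).coeFn_toLp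
  have hT : pb.constraintDiff = {z | ∃ y ∈ pb.selections, ∃ x ∈ pb.X, z = y - L x} := by
    ext z
    refine exists_congr fun y => and_congr_right fun _ => exists_congr fun x =>
      and_congr_right fun _ => ⟨fun hz => Lp.ext ?_, fun hz => ?_⟩
    · filter_upwards [hz, Lp.coeFn_sub y (L x), hL x] with ξ h1 h2 h3
      rw [h1, h2, Pi.sub_apply, h3]
    · filter_upwards [Lp.coeFn_sub y (L x), hL x] with ξ h2 h3
      rw [hz, h2, Pi.sub_apply, h3]
  have h0 := h.slater
  rw [hT] at h0
  obtain ⟨lam, hlam⟩ := exists_lagrange_multiplier L (p := pb.obj xs) h.X_compact h.X_convex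
    h.isClosed_selections h.convex_selections
    (h.convexOn_obj.subset (Set.subset_univ _) h.X_convex) h.continuous_obj.continuousOn
    (fun x hx hLx => hs.optimal x hx (by
      filter_upwards [hLx, hL x] with ξ h1 h2
      rwa [← h2])) h0
  refine ⟨lam, fun x hx y hy => ?_⟩
  have h1 := hlam x hx y hy
  have h2 : ∫ ξ, inner ℝ (pb.A ξ x - y ξ) (lam ξ) ∂pb.P = inner ℝ (L x - y) lam := by
    rw [L2.inner_def]
    refine integral_congr_ae ?_
    filter_upwards [Lp.coeFn_sub (L x) y, hL x] with ξ h3 h4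
    rw [h3, Pi.sub_apply, h4]
  rwa [h2]

end StochProblem.Assumptions

/-! ### Variance of batch means, with dependence on the past -/

section Sampling

variable {E Ω Ω' : Type*} [NormedAddCommGroup E] [InnerProductSpace ℝ E] [MeasurableSpace Ω]
  {P : Measure Ω}

theorem integrable_inner_of_memLp {g g' : Ω → E} (hg : MemLp g 2 P) (hg' : MemLp g' 2 P) :
    Integrable (fun ξ => inner ℝ (g ξ) (g' ξ)) P := by
  refine Integrable.mono' ((hg.integrable_norm_pow two_ne_zero).add
    (hg'.integrable_norm_pow two_ne_zero)) (hg.1.inner hg'.1) (ae_of_all _ fun ξ => ?_)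
  have h1 := abs_real_inner_le_norm (g ξ) (g' ξ)
  simp only [Pi.add_apply, Real.norm_eq_abs]
  nlinarith [sq_nonneg (‖g ξ‖ - ‖g' ξ‖), sq_nonneg (‖g ξ‖ + ‖g' ξ‖)]

omit [InnerProductSpace ℝ E] in
theorem lintegral_enorm_sq_eq {g : Ω → E} (hg : MemLp g 2 P) :
    ∫⁻ ξ, ‖g ξ‖ₑ ^ 2 ∂P = ENNReal.ofReal (∫ ξ, ‖g ξ‖ ^ 2 ∂P) := by
  rw [ofReal_integral_eq_lintegral_ofReal (hg.integrable_norm_pow two_ne_zero)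
    (ae_of_all _ fun ξ => sq_nonneg _)]
  refine lintegral_congr fun ξ => ?_
  rw [ENNReal.ofReal_pow (norm_nonneg _), ofReal_norm]

variable [IsProbabilityMeasure P]

/-- This is nonnegativity of the variance. -/
theorem integral_le_sqrt_integral_sq {g : Ω → ℝ} (hg : MemLp g 2 P) :
    ∫ ξ, g ξ ∂P ≤ √(∫ ξ, g ξ ^ 2 ∂P) := by
  refine Real.le_sqrt_of_sq_le ?_
  have h1 := variance_nonneg g P
  rw [variance_eq_sub hg] at h1
  simp only [Pi.pow_apply] at h1
  linarith

variable [CompleteSpace E] [MeasurableSpace E] [BorelSpace E] [SecondCountableTopology E]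

/-- The mean of `N` independent centered samples of `g` adds at most the `N`-th part of their
variance to a squared norm. -/
theorem lintegral_enorm_add_mean_sq_le {g : Ω → E} (hm : Measurable g) (hg : MemLp g 2 P)
    (h0 : ∫ ξ, g ξ ∂P = 0) (e : E) (N : ℕ) :
    ∫⁻ s, ‖e + (N : ℝ)⁻¹ • ∑ i : Fin N, g (s i)‖ₑ ^ 2 ∂(Measure.pi fun _ => P) ≤
      ‖e‖ₑ ^ 2 + ENNReal.ofReal ((∫ ξ, ‖g ξ‖ ^ 2 ∂P) / N) := by
  set μ : Measure (Fin N → Ω) := Measure.pi fun _ => P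
  set X : Fin N → (Fin N → Ω) → E := fun i s => g (s i)
  have hev : ∀ i, MeasurePreserving (fun s : Fin N → Ω => s i) μ P := fun i =>
    measurePreserving_eval (fun _ => P) i
  have hX : ∀ i, MemLp (X i) 2 μ := fun i => hg.comp_measurePreserving (hev i)
  have hX0 : ∀ i, ∫ s, X i s ∂μ = 0 := fun i => by
    rw [← h0, ← (hev i).map_eq, integral_map (hev i).measurable.aemeasurable
      hm.aestronglyMeasurable]
  have hX2 : ∀ i, ∫ s, ‖X i s‖ ^ 2 ∂μ = ∫ ξ, ‖g ξ‖ ^ 2 ∂P := fun i => by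
    conv_rhs => rw [← (hev i).map_eq]
    rw [integral_map (hev i).measurable.aemeasurable (hm.norm.pow_const 2).aestronglyMeasurable]
  have hind : iIndepFun X μ := iIndepFun_pi fun _ => hm.aemeasurable
  -- Independence and centering kill the cross terms.
  have hXX : ∀ i j, ∫ s, inner ℝ (X i s) (X j s) ∂μ =
      if i = j then ∫ ξ, ‖g ξ‖ ^ 2 ∂P else 0 := by
    intro i j
    split_ifs with hij
    · subst hij
      simp only [real_inner_self_eq_norm_sq]
      exact hX2 i
    · have h1 := (hind.indepFun hij).integral_bilin ((hX i).integrable one_le_two)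
        ((hX j).integrable one_le_two) (innerSL ℝ)
      simp only [hX0, map_zero] at h1
      exact h1
  have hs : MemLp (fun s => ∑ i, X i s) 2 μ := memLp_finsetSum _ fun i _ => hX i
  have hL : MemLp (fun s => e + (N : ℝ)⁻¹ • ∑ i, X i s) 2 μ :=
    (memLp_const e).add (hs.const_smul (N : ℝ)⁻¹)
  have hsum : ∫ s, ‖∑ i, X i s‖ ^ 2 ∂μ = N * ∫ ξ, ‖g ξ‖ ^ 2 ∂P := by
    simp only [← real_inner_self_eq_norm_sq, sum_inner, inner_sum]
    rw [integral_finsetSum _ fun i _ => integrable_finsetSum _ fun j _ =>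
      integrable_inner_of_memLp (hX j) (hX i)]
    simp only [integral_finsetSum _ fun j _ => integrable_inner_of_memLp (hX j) (hX _)]
    simp [hXX]
  have hs0 : ∫ s, ∑ i, X i s ∂μ = 0 := by
    rw [integral_finsetSum _ fun i _ => (hX i).integrable one_le_two]
    simp [hX0]
  have htot : ∫ s, ‖e + (N : ℝ)⁻¹ • ∑ i, X i s‖ ^ 2 ∂μ =
      ‖e‖ ^ 2 + (N : ℝ)⁻¹ ^ 2 * (N * ∫ ξ, ‖g ξ‖ ^ 2 ∂P) := by
    have h1 : ∀ s, ‖e + (N : ℝ)⁻¹ • ∑ i, X i s‖ ^ 2 = ‖e‖ ^ 2 +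
        2 * (N : ℝ)⁻¹ * inner ℝ e (∑ i, X i s) + (N : ℝ)⁻¹ ^ 2 * ‖∑ i, X i s‖ ^ 2 := fun s => by
      rw [norm_add_sq_real, real_inner_smul_right, norm_smul, mul_pow, Real.norm_eq_abs, sq_abs]
      ring
    have i1 := ((hs.integrable one_le_two).const_inner (𝕜 := ℝ) e).const_mul (2 * (N : ℝ)⁻¹)
    have i2 : Integrable (fun s => ‖e‖ ^ 2 + 2 * (N : ℝ)⁻¹ * inner ℝ e (∑ i, X i s)) μ :=
      (integrable_const _).add i1
    simp only [h1]
    rw [integral_add i2 ((hs.integrable_norm_pow two_ne_zero).const_mul _),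
      integral_add (integrable_const _) i1, integral_const_mul, integral_const_mul, hsum,
      integral_inner (hs.integrable one_le_two), hs0]
    simp
  refine le_of_eq ?_
  calc ∫⁻ s, ‖e + (N : ℝ)⁻¹ • ∑ i : Fin N, g (s i)‖ₑ ^ 2 ∂μ
      = ENNReal.ofReal (‖e‖ ^ 2 + (N : ℝ)⁻¹ ^ 2 * (N * ∫ ξ, ‖g ξ‖ ^ 2 ∂P)) := by
        rw [← htot]
        exact lintegral_enorm_sq_eq hL
    _ = ENNReal.ofReal (‖e‖ ^ 2 + (∫ ξ, ‖g ξ‖ ^ 2 ∂P) / N) := by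
        congr 2
        -- For an empty batch both sides agree, since inversion of and division by 0 give 0.
        rcases eq_or_ne (N : ℝ) 0 with hN | hN
        · simp [hN]
        · field_simp
    _ = _ := by
        rw [ENNReal.ofReal_add (sq_nonneg _)
          (div_nonneg (integral_nonneg fun _ => sq_nonneg _) N.cast_nonneg),
          ENNReal.ofReal_pow (norm_nonneg _), ofReal_norm]

/-- Conditional version of `lintegral_enorm_add_mean_sq_le`: the estimation error `e Z` and the
sampled function `g Z` may depend on past information `Z`. -/
theorem IsFreshBatch.lintegral_enorm_add_mean_sq_le {past now mΩ' : MeasurableSpace Ω'}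
    {μ : Measure Ω'} [IsProbabilityMeasure μ] {N : ℕ} {Y : Ω' → Fin N → Ω}
    (hY : IsFreshBatch past now P μ Y) (hpast : past ≤ mΩ') (hnow : now ≤ mΩ')
    {α : Type*} [MeasurableSpace α] {Z : Ω' → α} (hZ : Measurable[past] Z)
    {e : α → E} (he : Measurable e) {g : α → Ω → E} (hg : Measurable (Function.uncurry g))
    {c : ℝ} (hL : ∀ ω, MemLp (g (Z ω)) 2 P) (h0 : ∀ ω, ∫ ξ, g (Z ω) ξ ∂P = 0)
    (hc : ∀ ω, ∫ ξ, ‖g (Z ω) ξ‖ ^ 2 ∂P ≤ c) :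
    ∫⁻ ω, ‖e (Z ω) + (N : ℝ)⁻¹ • ∑ i, g (Z ω) (Y ω i)‖ₑ ^ 2 ∂μ ≤
      ∫⁻ ω, ‖e (Z ω)‖ₑ ^ 2 ∂μ + ENNReal.ofReal (c / N) := by
  have hZ' : Measurable Z := hZ.mono hpast le_rfl
  have hY' : Measurable Y := hY.measurable.mono hnow le_rfl
  have hind : IndepFun Z Y μ := by
    rw [IndepFun_iff_Indep]
    exact indep_of_indep_of_le_left hY.indep.symm hZ.comap_le
  have hmap := (indepFun_iff_map_prod_eq_prod_map_map hZ'.aemeasurable hY'.aemeasurable).1 hind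
  set F : α × (Fin N → Ω) → ENNReal :=
    fun p => ‖e p.1 + (N : ℝ)⁻¹ • ∑ i, g p.1 (p.2 i)‖ₑ ^ 2
  have hF : Measurable F := by
    have h1 : ∀ i : Fin N, Measurable fun p : α × (Fin N → Ω) => g p.1 (p.2 i) := fun i =>
      hg.comp (measurable_fst.prodMk ((measurable_pi_apply i).comp measurable_snd))
    exact (((he.comp measurable_fst).add
      ((Finset.measurable_sum _ fun i _ => h1 i).const_smul (N : ℝ)⁻¹)).enorm).pow_const 2
  -- By independence the joint law of past and batch is a product, so Tonelli allows the past to be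
  -- frozen. Using `∫⁻` avoids assuming integrability of the earlier error.
  have h1 : ∫⁻ ω, F (Z ω, Y ω) ∂μ = ∫⁻ ω, ∫⁻ s, F (Z ω, s) ∂(Measure.pi fun _ => P) ∂μ := by
    rw [← lintegral_map hF (hZ'.prodMk hY'), hmap, hY.law, lintegral_prod _ hF.aemeasurable,
      lintegral_map hF.lintegral_prod_right' hZ']
  calc ∫⁻ ω, F (Z ω, Y ω) ∂μ = ∫⁻ ω, ∫⁻ s, F (Z ω, s) ∂(Measure.pi fun _ => P) ∂μ := h1
    _ ≤ ∫⁻ ω, (‖e (Z ω)‖ₑ ^ 2 + ENNReal.ofReal (c / N)) ∂μ := by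
        refine lintegral_mono fun ω => ?_
        refine (_root_.lintegral_enorm_add_mean_sq_le (hg.comp measurable_prodMk_left) (hL ω)
          (h0 ω) (e (Z ω)) N).trans ?_
        gcongr
        exact hc ω
    _ = _ := by
        rw [lintegral_add_right _ measurable_const]
        simp

end Sampling

/-! ### Epochs as one continuous sequence of steps -/

section Epochs

theorem one_le_epochLen (t : ℕ) : 1 ≤ epochLen t := Nat.one_le_two_pow

theorem epochLen_succ {t : ℕ} (ht : 1 ≤ t) : epochLen (t + 1) = 2 * epochLen t := by
  obtain ⟨s, rfl⟩ := Nat.exists_eq_add_of_le' ht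
  simp [epochLen, pow_succ, mul_comm]

/-- Induction along the iterations of the algorithm. -/
theorem epoch_induction {motive : ℕ → ℕ → Prop} (start : motive 1 1)
    (epoch : ∀ t, 1 ≤ t → motive t (epochLen t + 1) → motive (t + 1) 1)
    (step : ∀ t k, 1 ≤ t → 1 ≤ k → k ≤ epochLen t → motive t k → motive t (k + 1))
    {t k : ℕ} (ht : 1 ≤ t) (hk : 1 ≤ k) (hkt : k ≤ epochLen t + 1) : motive t k := by
  have inner : ∀ t, 1 ≤ t → motive t 1 → ∀ k, 1 ≤ k → k ≤ epochLen t + 1 → motive t k := by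
    intro t ht h1 k hk
    induction k, hk using Nat.le_induction with
    | base => exact fun _ => h1
    | succ k hk ih => exact fun hle => step t k ht hk (by omega) (ih (by omega))
  refine inner t ht ?_ k hk hkt
  clear hkt
  induction t, ht using Nat.le_induction with
  | base => exact start
  | succ t ht ih => exact epoch t ht (inner t ht ih _ (by omega) le_rfl)

end Epochs

/-! ### Increments and variance of the sampled smoothed gradients -/

/-- The scale of the increments of the sampled smoothed gradients. -/
def driftConst (Lf LA D β₀ : ℝ) : ℝ := 4 * |Lf| * D + 5 * LA * D / β₀

namespace StochProblem.Assumptions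

variable {d m : ℕ} {Ω : Type*} [MeasurableSpace Ω] {pb : StochProblem d m Ω} {Lf LA D : ℝ}
  {xs : Euc d} (h : pb.Assumptions Lf LA D)
include h

theorem measurable_meanGrad (β : ℝ) : Measurable (pb.meanGrad β) :=
  (h.measurable_uncurry_gradSmoothed β).stronglyMeasurable.integral_prod_right'.measurable

theorem measurable_meanSqViol : Measurable pb.meanSqViol :=
  (h.measurable_uncurry_viol.pow_const 2).stronglyMeasurable.integral_prod_right'.measurable

theorem measurable_batchGrad (β : ℝ) (N : ℕ) :
    Measurable fun p : Euc d × (Fin N → Ω) => pb.batchGrad β p.1 p.2 := by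
  refine (Finset.measurable_sum _ fun i _ => ?_).const_smul (N : ℝ)⁻¹
  exact (h.measurable_uncurry_gradSmoothed β).comp
    (measurable_fst.prodMk ((measurable_pi_apply i).comp measurable_snd))

theorem norm_adjoint_residual_le_ae (hs : pb.IsSolution xs) :
    ∀ᵐ ξ ∂pb.P, ∀ x ∈ pb.X,
      ‖ContinuousLinearMap.adjoint (pb.A ξ) (pb.residual x ξ)‖ ≤ LA * D := by
  filter_upwards [h.viol_le_ae hs] with ξ hξ x hx
  calc _ ≤ √LA * ‖pb.residual x ξ‖ := h.norm_adjoint_A_apply_le ξ _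
    _ ≤ √LA * (√LA * D) := by
      rw [h.norm_residual]
      gcongr
      exact hξ x hx
    _ = LA * D := by rw [← mul_assoc, Real.mul_self_sqrt h.LA_nonneg]

/-- The difference splits into the change of ∇f, the change of the residual at fixed β, and the
change of 1/β against a bounded residual. -/
theorem norm_gradSmoothed_sub_le_ae (hs : pb.IsSolution xs) (β β' : ℝ) :
    ∀ᵐ ξ ∂pb.P, ∀ x ∈ pb.X, ∀ y ∈ pb.X, ‖pb.gradSmoothed β x ξ - pb.gradSmoothed β' y ξ‖ ≤
      (|Lf| + |β⁻¹| * LA) * ‖x - y‖ + |β⁻¹ - β'⁻¹| * (LA * D) := by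
  filter_upwards [h.norm_adjoint_residual_le_ae hs] with ξ hξ x hx y hy
  have h1 : pb.gradSmoothed β x ξ - pb.gradSmoothed β' y ξ = (pb.gradf x ξ - pb.gradf y ξ) +
      β⁻¹ • ContinuousLinearMap.adjoint (pb.A ξ) (pb.residual x ξ - pb.residual y ξ) +
      (β⁻¹ - β'⁻¹) • ContinuousLinearMap.adjoint (pb.A ξ) (pb.residual y ξ) := by
    rw [h.gradSmoothed_eq, h.gradSmoothed_eq, map_sub, smul_sub, sub_smul]
    abel
  have h2 : ‖ContinuousLinearMap.adjoint (pb.A ξ) (pb.residual x ξ - pb.residual y ξ)‖ ≤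
      LA * ‖x - y‖ := by
    refine (h.norm_adjoint_A_apply_le ξ _).trans ?_
    calc _ ≤ √LA * (√LA * ‖x - y‖) := by
          gcongr
          exact h.norm_residual_sub_le x y ξ
      _ = LA * ‖x - y‖ := by rw [← mul_assoc, Real.mul_self_sqrt h.LA_nonneg]
  rw [h1]
  refine (norm_add₃_le).trans ?_
  rw [norm_smul, norm_smul, Real.norm_eq_abs, Real.norm_eq_abs]
  have h3 := h.norm_gradf_sub_le x y ξ
  have h4 := mul_le_mul_of_nonneg_left h2 (abs_nonneg β⁻¹)
  have h5 := mul_le_mul_of_nonneg_left (hξ y hy) (abs_nonneg (β⁻¹ - β'⁻¹))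
  linarith

/-- An almost sure bound on the increment also bounds its mean, so the centered increment is at most
2c. No variance assumption on ∇f is needed for increments. -/
theorem centered_gradSmoothed_sub (hs : pb.IsSolution xs) (β β' : ℝ) {x y : Euc d} {c : ℝ}
    (hx : x ∈ pb.X) (hy : y ∈ pb.X)
    (hc : (|Lf| + |β⁻¹| * LA) * ‖x - y‖ + |β⁻¹ - β'⁻¹| * (LA * D) ≤ c) :
    let g := fun ξ => (pb.gradSmoothed β x ξ - pb.gradSmoothed β' y ξ) -
      (pb.meanGrad β x - pb.meanGrad β' y)
    MemLp g 2 pb.P ∧ ∫ ξ, g ξ ∂pb.P = 0 ∧ ∫ ξ, ‖g ξ‖ ^ 2 ∂pb.P ≤ 4 * c ^ 2 := by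
  intro g
  have hix := h.integrable_gradSmoothed hs β hx
  have hiy := h.integrable_gradSmoothed hs β' hy
  have hmean : pb.meanGrad β x - pb.meanGrad β' y =
      ∫ ξ, (pb.gradSmoothed β x ξ - pb.gradSmoothed β' y ξ) ∂pb.P := by
    rw [integral_sub hix hiy]
    rfl
  have hae : ∀ᵐ ξ ∂pb.P, ‖pb.gradSmoothed β x ξ - pb.gradSmoothed β' y ξ‖ ≤ c := by
    filter_upwards [h.norm_gradSmoothed_sub_le_ae hs β β'] with ξ hξ
    exact (hξ x hx y hy).trans hc
  have hmc : ‖pb.meanGrad β x - pb.meanGrad β' y‖ ≤ c := by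
    rw [hmean]
    simpa using norm_integral_le_of_norm_le_const hae
  have hgc : ∀ᵐ ξ ∂pb.P, ‖g ξ‖ ≤ 2 * c := by
    filter_upwards [hae] with ξ hξ
    exact (_root_.norm_sub_le _ _).trans (by linarith)
  have hgm : Measurable g := ((h.measurable_gradSmoothed β x).sub
    (h.measurable_gradSmoothed β' y)).sub_const _
  have hL : MemLp g 2 pb.P := MemLp.of_bound hgm.aestronglyMeasurable _ hgc
  refine ⟨hL, ?_, ?_⟩
  · have h1 : Integrable (fun ξ => pb.gradSmoothed β x ξ - pb.gradSmoothed β' y ξ) pb.P :=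
      hix.sub hiy
    simp only [g]
    rw [integral_sub h1 (integrable_const _), ← hmean]
    simp
  · have h1 : ∫ ξ, ‖g ξ‖ ^ 2 ∂pb.P ≤ ∫ _, 4 * c ^ 2 ∂pb.P := by
      refine integral_mono_ae (hL.integrable_norm_pow two_ne_zero) (integrable_const _) ?_
      filter_upwards [hgc] with ξ hξ
      nlinarith [norm_nonneg (g ξ)]
    simpa using h1

/-- Only ∇f needs the variance bound: the centered penalty gradient is almost surely at most
2|β⁻¹|·LA·D, and (a + b)² ≤ 2a² + 2b² yields the constants 2 and 8. -/
theorem centered_gradSmoothed (hs : pb.IsSolution xs) {σ β : ℝ} (hv : pb.VarianceBound σ)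
    {x : Euc d} (hx : x ∈ pb.X) :
    let g := fun ξ => pb.gradSmoothed β x ξ - pb.meanGrad β x
    MemLp g 2 pb.P ∧ ∫ ξ, g ξ ∂pb.P = 0 ∧
      ∫ ξ, ‖g ξ‖ ^ 2 ∂pb.P ≤ 2 * σ ^ 2 + 8 * (β⁻¹) ^ 2 * (LA * D) ^ 2 := by
  intro g
  have hix := h.integrable_gradSmoothed hs β hx
  have hia := h.integrable_adjoint_residual hs hx
  have hgm : Measurable g := (h.measurable_gradSmoothed β x).sub_const _
  obtain ⟨hvi, hvle⟩ := hv x hx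
  set a : Euc d := ∫ ξ, ContinuousLinearMap.adjoint (pb.A ξ) (pb.residual x ξ) ∂pb.P
  have hgrad : gradient pb.obj x = ∫ ξ, pb.gradf x ξ ∂pb.P := (h.gradf_unbiased x).gradient
  have hmean : pb.meanGrad β x = gradient pb.obj x + β⁻¹ • a := by
    rw [hgrad, meanGrad]
    simp only [h.gradSmoothed_eq]
    rw [integral_add (h.gradf_integrable x) (by exact hia.smul β⁻¹), integral_smul]
  have ha : ‖a‖ ≤ LA * D := by
    have h1 : ∀ᵐ ξ ∂pb.P, ‖ContinuousLinearMap.adjoint (pb.A ξ) (pb.residual x ξ)‖ ≤ LA * D := by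
      filter_upwards [h.norm_adjoint_residual_le_ae hs] with ξ hξ using hξ x hx
    simpa using norm_integral_le_of_norm_le_const h1
  have hle : ∀ᵐ ξ ∂pb.P, ‖g ξ‖ ^ 2 ≤
      2 * ‖pb.gradf x ξ - gradient pb.obj x‖ ^ 2 + 8 * (β⁻¹) ^ 2 * (LA * D) ^ 2 := by
    filter_upwards [h.norm_adjoint_residual_le_ae hs] with ξ hξ
    have h1 : g ξ = (pb.gradf x ξ - gradient pb.obj x) +
        β⁻¹ • (ContinuousLinearMap.adjoint (pb.A ξ) (pb.residual x ξ) - a) := by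
      simp only [g]
      rw [h.gradSmoothed_eq, hmean, smul_sub]
      abel
    have h2 : ‖g ξ‖ ≤ ‖pb.gradf x ξ - gradient pb.obj x‖ + |β⁻¹| * (2 * (LA * D)) := by
      rw [h1]
      refine (norm_add_le _ _).trans ?_
      rw [norm_smul, Real.norm_eq_abs]
      gcongr
      exact (_root_.norm_sub_le _ _).trans (by linarith [hξ x hx])
    have h3 : ‖g ξ‖ ^ 2 ≤ (‖pb.gradf x ξ - gradient pb.obj x‖ + |β⁻¹| * (2 * (LA * D))) ^ 2 := by
      gcongr
    rw [← sq_abs β⁻¹]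
    nlinarith [sq_nonneg (‖pb.gradf x ξ - gradient pb.obj x‖ - |β⁻¹| * (2 * (LA * D)))]
  have hbi : Integrable (fun ξ => 2 * ‖pb.gradf x ξ - gradient pb.obj x‖ ^ 2 +
      8 * (β⁻¹) ^ 2 * (LA * D) ^ 2) pb.P := (hvi.const_mul 2).add (integrable_const _)
  have hgi : Integrable (fun ξ => ‖g ξ‖ ^ 2) pb.P := by
    refine hbi.mono' (hgm.norm.pow_const 2).aestronglyMeasurable ?_
    filter_upwards [hle] with ξ hξ
    rwa [Real.norm_eq_abs, abs_of_nonneg (sq_nonneg _)]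
  refine ⟨(memLp_two_iff_integrable_sq_norm hgm.aestronglyMeasurable).2 hgi, ?_, ?_⟩
  · simp only [g]
    rw [integral_sub hix (integrable_const _), meanGrad]
    simp
  · refine (integral_mono_ae hgi hbi hle).trans ?_
    rw [integral_add (hvi.const_mul 2) (integrable_const _), integral_const_mul]
    simp only [integral_const, probReal_univ, one_smul]
    linarith

end StochProblem.Assumptions

/-! ### Adaptedness and the mean squared error of the gradient estimator -/

namespace HSpiderFW

variable {d m : ℕ} {Ω Ω' : Type*} [MeasurableSpace Ω] [mΩ' : MeasurableSpace Ω']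
  {pb : StochProblem d m Ω} {μ : Measure Ω'} {β₀ : ℝ} {x₁ : Euc d} {q : ℕ → ℕ}
  (r : HSpiderFW pb μ β₀ x₁ q) {Lf LA D : ℝ} {xs : Euc d}

theorem stepSize_mem {t k : ℕ} (hk : 1 ≤ k) : stepSize t k ∈ Set.Icc (0 : ℝ) 1 := by
  have h1 : (1 : ℝ) ≤ epochLen t := by exact_mod_cast one_le_epochLen t
  have h2 : (1 : ℝ) ≤ k := by exact_mod_cast hk
  refine ⟨by rw [stepSize]; positivity, ?_⟩
  rw [stepSize, div_le_one (by positivity)]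
  linarith

theorem x_mem (hX : Convex ℝ pb.X) {t k : ℕ} (ht : 1 ≤ t) (hk : 1 ≤ k)
    (hkt : k ≤ epochLen t + 1) (ω : Ω') : r.x t k ω ∈ pb.X := by
  refine epoch_induction (motive := fun t k => r.x t k ω ∈ pb.X) ?_ ?_ ?_ ht hk hkt
  · rw [r.x_start]
    exact r.start_mem
  · intro t ht h1
    rwa [r.x_epoch t ht]
  · intro t k ht hk hkt h1
    rw [r.x_step t k ht hk hkt]
    exact hX.add_smul_sub_mem h1 (r.w_lmo t k ht hk hkt ω).1 (stepSize_mem hk)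

/-- The iterate is known one global step before its gradient estimator, so the batch of step (t, k)
is independent of it. At an epoch change the two indices agree because K_{t+1} = 2 K_t. -/
theorem measurable_hist_x {t k : ℕ} (ht : 1 ≤ t) (hk : 1 ≤ k) (hkt : k ≤ epochLen t + 1) :
    Measurable[r.hist (epochLen t + k - 1)] (r.x t k) := by
  refine epoch_induction (motive := fun t k => Measurable[r.hist (epochLen t + k - 1)] (r.x t k))
    ?_ ?_ ?_ ht hk hkt
  · rw [funext r.x_start]
    exact measurable_const
  · intro t ht h1
    rw [funext (r.x_epoch t ht), epochLen_succ ht]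
    exact h1.mono (r.hist.mono (by omega)) le_rfl
  · intro t k ht hk hkt h1
    rw [funext (r.x_step t k ht hk hkt), show epochLen t + (k + 1) - 1 = epochLen t + k by omega]
    have h2 : Measurable[r.hist (epochLen t + k)] (r.x t k) :=
      h1.mono (r.hist.mono (by omega)) le_rfl
    exact h2.add (((r.w_adapted t k ht hk hkt).sub h2).const_smul (stepSize t k))

theorem measurable_x {t k : ℕ} (ht : 1 ≤ t) (hk : 1 ≤ k) (hkt : k ≤ epochLen t + 1) :
    Measurable (r.x t k) :=
  (r.measurable_hist_x ht hk hkt).mono (r.hist.le _) le_rfl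

theorem measurable_hist_v (h : pb.Assumptions Lf LA D) {t : ℕ} (ht : 1 ≤ t)
    (h1 : Measurable[r.hist (epochLen t + 1)] (r.v t 1)) {k : ℕ} (hk : 1 ≤ k)
    (hkt : k ≤ epochLen t) : Measurable[r.hist (epochLen t + k)] (r.v t k) := by
  induction k, hk using Nat.le_induction with
  | base => exact h1
  | succ k hk ih =>
    rw [funext (r.v_inner t (k + 1) ht (by omega) hkt), Nat.add_sub_cancel]
    have hv : Measurable[r.hist (epochLen t + (k + 1))] (r.v t k) :=
      (ih (by omega)).mono (r.hist.mono (by omega)) le_rfl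
    have hx : Measurable[r.hist (epochLen t + (k + 1))] (r.x t k) :=
      (r.measurable_hist_x ht hk (by omega)).mono (r.hist.mono (by omega)) le_rfl
    have hx' : Measurable[r.hist (epochLen t + (k + 1))] (r.x t (k + 1)) :=
      (r.measurable_hist_x ht (by omega) (by omega)).mono (r.hist.mono (by omega)) le_rfl
    have hS := (r.S_fresh t (k + 1) ht (by omega) hkt).measurable
    have h2 := (h.measurable_batchGrad (smoothPar β₀ t k) (epochLen t)).comp (hx.prodMk hS)
    have h3 := (h.measurable_batchGrad (smoothPar β₀ t (k + 1)) (epochLen t)).comp (hx'.prodMk hS)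
    exact (hv.sub h2).add h3

/-- The error of the gradient estimator. -/
def gradError (t k : ℕ) (ω : Ω') : Euc d :=
  r.v t k ω - pb.meanGrad (smoothPar β₀ t k) (r.x t k ω)

theorem measurable_gradError (h : pb.Assumptions Lf LA D) {t : ℕ} (ht : 1 ≤ t)
    (h1 : Measurable[r.hist (epochLen t + 1)] (r.v t 1)) {k : ℕ} (hk : 1 ≤ k)
    (hkt : k ≤ epochLen t) : Measurable (r.gradError t k) :=
  ((r.measurable_hist_v h ht h1 hk hkt).mono (r.hist.le _) le_rfl).sub
    ((h.measurable_meanGrad _).comp (r.measurable_x ht hk (by omega)))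

/-- With s = √(n + 1), a move of at most 4D/s² meets the constant |Lf| + LA s/β₀, and 1/β grows by
at most 1/(s β₀). The coefficient 5 in `driftConst` is 4 from the move plus 1 from the change of β.
-/
theorem drift_le (hβ : 0 < β₀) (hD : 0 ≤ D) (hLA : 0 ≤ LA) {t k : ℕ} (hk : 1 ≤ k) {δ : ℝ}
    (hδ : δ ≤ stepSize t k * D) :
    (|Lf| + |(smoothPar β₀ t (k + 1))⁻¹| * LA) * δ +
      |(smoothPar β₀ t (k + 1))⁻¹ - (smoothPar β₀ t k)⁻¹| * (LA * D) ≤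
    driftConst Lf LA D β₀ / √(epochLen t) := by
  have hK : (1 : ℝ) ≤ epochLen t := by exact_mod_cast one_le_epochLen t
  have hk' : (1 : ℝ) ≤ k := by exact_mod_cast hk
  set K : ℝ := (epochLen t : ℝ)
  set n : ℝ := K + k with hn
  set s := √(n + 1) with hs
  set s' := √n with hs'
  have hss : s ^ 2 = n + 1 := Real.sq_sqrt (by positivity)
  have hss' : s' ^ 2 = n := Real.sq_sqrt (by positivity)
  have hs0 : 0 < s := Real.sqrt_pos.2 (by positivity)
  have hs0' : 0 < s' := Real.sqrt_pos.2 (by positivity)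
  have hle : s' ≤ s := Real.sqrt_le_sqrt (by linarith)
  have hK0 : 0 < √K := Real.sqrt_pos.2 (by positivity)
  have hKs : √K ≤ s := Real.sqrt_le_sqrt (by linarith)
  have e1 : (smoothPar β₀ t (k + 1))⁻¹ = s / β₀ := by
    rw [smoothPar, inv_div, hs, hn]
    push_cast
    rw [add_assoc]
  have e2 : (smoothPar β₀ t k)⁻¹ = s' / β₀ := by rw [smoothPar, inv_div]
  have e3 : s / β₀ - s' / β₀ = (s - s') / β₀ := by ring
  -- Here s² - s s' ≤ s² - s'² = 1.
  have hdiff : s - s' ≤ 1 / s := by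
    rw [le_div_iff₀ hs0]
    nlinarith
  rw [e1, e2, e3, abs_of_nonneg (show 0 ≤ s / β₀ by positivity),
    abs_of_nonneg (show 0 ≤ (s - s') / β₀ from div_nonneg (by linarith) hβ.le)]
  have hstep : stepSize t k ≤ 4 / s ^ 2 := by
    rw [stepSize, hss, div_le_div_iff₀ (by positivity) (by positivity)]
    linarith
  have hδ' : δ ≤ 4 / s ^ 2 * D := hδ.trans (by gcongr)
  have hs1 : 1 ≤ s := by
    rw [hs]
    exact Real.one_le_sqrt.2 (by linarith)
  have hsK : 1 / s ≤ 1 / √K := one_div_le_one_div_of_le hK0 hKs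
  calc (|Lf| + s / β₀ * LA) * δ + (s - s') / β₀ * (LA * D)
      ≤ (|Lf| + s / β₀ * LA) * (4 / s ^ 2 * D) + (1 / s) / β₀ * (LA * D) := by gcongr
    _ = (4 * |Lf| * D * (1 / s) + 5 * LA * D / β₀) * (1 / s) := by
      field_simp
      ring
    _ ≤ (4 * |Lf| * D * 1 + 5 * LA * D / β₀) * (1 / √K) := by
      gcongr
      rw [div_le_one hs0]
      exact hs1
    _ = driftConst Lf LA D β₀ / √K := by
      rw [driftConst]
      ring

variable [IsProbabilityMeasure μ]

/-- The new error is the old one plus the batch mean of a centered increment that is bounded given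
the past. The old error is known before the batch is drawn, so squared errors add. -/
theorem lintegral_gradError_succ_le (h : pb.Assumptions Lf LA D) (hs : pb.IsSolution xs)
    (hβ : 0 < β₀) {t : ℕ} (ht : 1 ≤ t)
    (h1 : Measurable[r.hist (epochLen t + 1)] (r.v t 1)) {k : ℕ} (hk : 1 ≤ k)
    (hkt : k + 1 ≤ epochLen t) :
    ∫⁻ ω, ‖r.gradError t (k + 1) ω‖ₑ ^ 2 ∂μ ≤ ∫⁻ ω, ‖r.gradError t k ω‖ₑ ^ 2 ∂μ +
      ENNReal.ofReal (4 * driftConst Lf LA D β₀ ^ 2 / (epochLen t : ℝ) ^ 2) := by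
  set β := smoothPar β₀ t (k + 1)
  set β' := smoothPar β₀ t k
  have hK : (0 : ℝ) < epochLen t := by exact_mod_cast one_le_epochLen t
  have hxX := fun ω => r.x_mem h.X_convex ht hk (by omega) ω
  have hxX' := fun ω => r.x_mem h.X_convex ht (k := k + 1) (by omega) (by omega) ω
  have hfresh := r.S_fresh t (k + 1) ht (by omega) hkt
  rw [show epochLen t + (k + 1) - 1 = epochLen t + k by omega] at hfresh
  -- The past that the old error and the increment depend on: two consecutive iterates and the old
  -- estimator.
  set Z : Ω' → Euc d × Euc d × Euc d := fun ω => (r.x t k ω, r.x t (k + 1) ω, r.v t k ω)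
  have hZ : Measurable[r.hist (epochLen t + k)] Z :=
    ((r.measurable_hist_x ht hk (by omega)).mono (r.hist.mono (by omega)) le_rfl).prodMk
      (((r.measurable_hist_x ht (by omega) (by omega)).mono (r.hist.mono (by omega)) le_rfl).prodMk
        (r.measurable_hist_v h ht h1 hk (by omega)))
  set e : Euc d × Euc d × Euc d → Euc d := fun z => z.2.2 - pb.meanGrad β' z.1
  have he : Measurable e :=
    measurable_snd.snd.sub ((h.measurable_meanGrad β').comp measurable_fst)
  set g : Euc d × Euc d × Euc d → Ω → Euc d := fun z ξ =>
    (pb.gradSmoothed β z.2.1 ξ - pb.gradSmoothed β' z.1 ξ) -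
      (pb.meanGrad β z.2.1 - pb.meanGrad β' z.1)
  have hg : Measurable (Function.uncurry g) :=
    (((h.measurable_uncurry_gradSmoothed β).comp
      (measurable_fst.snd.fst.prodMk measurable_snd)).sub
      ((h.measurable_uncurry_gradSmoothed β').comp
      (measurable_fst.fst.prodMk measurable_snd))).sub
      (((h.measurable_meanGrad β).comp measurable_fst.snd.fst).sub
        ((h.measurable_meanGrad β').comp measurable_fst.fst))
  have hcent := fun ω => h.centered_gradSmoothed_sub hs β β' (hxX' ω) (hxX ω)
    (drift_le hβ h.D_nonneg h.LA_nonneg (t := t) hk (δ := ‖r.x t (k + 1) ω - r.x t k ω‖) (by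
      rw [r.x_step t k ht hk (by omega), add_sub_cancel_left, norm_smul, Real.norm_eq_abs,
        abs_of_nonneg (stepSize_mem hk).1]
      exact mul_le_mul_of_nonneg_left
        (h.norm_sub_le (r.w_lmo t k ht hk (by omega) ω).1 (hxX ω)) (stepSize_mem hk).1))
  have hmain := hfresh.lintegral_enorm_add_mean_sq_le (r.hist.le _) (r.hist.le _) hZ he hg
    (fun ω => (hcent ω).1) (fun ω => (hcent ω).2.1) (fun ω => (hcent ω).2.2)
  have hval : ∀ ω, e (Z ω) + (epochLen t : ℝ)⁻¹ • ∑ i, g (Z ω) (r.S t (k + 1) ω i) =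
      r.gradError t (k + 1) ω := by
    intro ω
    simp only [e, Z, g, gradError]
    rw [r.v_inner t (k + 1) ht (by omega) hkt, Nat.add_sub_cancel, Finset.sum_sub_distrib,
      Finset.sum_sub_distrib, Finset.sum_const, Finset.card_univ, Fintype.card_fin,
      ← Nat.cast_smul_eq_nsmul ℝ, smul_sub, smul_smul, inv_mul_cancel₀ hK.ne', one_smul, smul_sub,
      StochProblem.batchGrad, StochProblem.batchGrad]
    abel
  simp only [hval] at hmain
  refine hmain.trans (add_le_add le_rfl (ENNReal.ofReal_le_ofReal (le_of_eq ?_)))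
  rw [div_pow, Real.sq_sqrt hK.le]
  field_simp

/-- The outer batches estimate the gradient with mean squared error at most `V / K_t`. -/
structure OuterAccurate (r : HSpiderFW pb μ β₀ x₁ q) (V : ℝ) : Prop where
  measurable : ∀ t, 1 ≤ t → Measurable[r.hist (epochLen t + 1)] (r.v t 1)
  error_le : ∀ t, 1 ≤ t →
    ∫⁻ ω, ‖r.gradError t 1 ω‖ₑ ^ 2 ∂μ ≤ ENNReal.ofReal (V / epochLen t)

variable {r}

theorem lintegral_gradError_le {V : ℝ} (hV : 0 ≤ V) (ho : r.OuterAccurate V)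
    (h : pb.Assumptions Lf LA D) (hs : pb.IsSolution xs) (hβ : 0 < β₀) {t : ℕ} (ht : 1 ≤ t)
    {k : ℕ} (hk : 1 ≤ k) (hkt : k ≤ epochLen t) :
    ∫⁻ ω, ‖r.gradError t k ω‖ₑ ^ 2 ∂μ ≤ ENNReal.ofReal
      (2 * (V + 4 * driftConst Lf LA D β₀ ^ 2) / ((epochLen t : ℝ) + k)) := by
  have hK : (0 : ℝ) < epochLen t := by exact_mod_cast one_le_epochLen t
  have hrec : ∀ k, 1 ≤ k → k ≤ epochLen t → ∫⁻ ω, ‖r.gradError t k ω‖ₑ ^ 2 ∂μ ≤ ENNReal.ofReal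
      (V / epochLen t + k * (4 * driftConst Lf LA D β₀ ^ 2 / (epochLen t : ℝ) ^ 2)) := by
    intro k hk
    induction k, hk using Nat.le_induction with
    | base =>
      intro _
      refine (ho.error_le t ht).trans (ENNReal.ofReal_le_ofReal ?_)
      have : 0 ≤ ((1 : ℕ) : ℝ) * (4 * driftConst Lf LA D β₀ ^ 2 / (epochLen t : ℝ) ^ 2) := by
        positivity
      linarith
    | succ k hk ih =>
      intro hkt
      refine (r.lintegral_gradError_succ_le h hs hβ ht (ho.measurable t ht) hk hkt).trans ?_
      refine (add_le_add (ih (by omega)) le_rfl).trans (le_of_eq ?_)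
      rw [← ENNReal.ofReal_add (by positivity) (by positivity)]
      congr 1
      push_cast
      ring
  refine (hrec k hk hkt).trans (ENNReal.ofReal_le_ofReal ?_)
  have hk' : (k : ℝ) ≤ epochLen t := by exact_mod_cast hkt
  calc V / epochLen t + k * (4 * driftConst Lf LA D β₀ ^ 2 / (epochLen t : ℝ) ^ 2)
      ≤ V / epochLen t + epochLen t * (4 * driftConst Lf LA D β₀ ^ 2 / (epochLen t : ℝ) ^ 2) := by
        gcongr
    _ = (V + 4 * driftConst Lf LA D β₀ ^ 2) / epochLen t := by field_simp
    -- The factor 2 comes from K_t + k ≤ 2 K_t.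
    _ ≤ _ := by
      rw [div_le_div_iff₀ hK (by positivity)]
      have : 0 ≤ V + 4 * driftConst Lf LA D β₀ ^ 2 := by positivity
      nlinarith

/-- The finite bound on the lower integral is what provides square integrability of the error;
Jensen then bounds its mean norm. -/
theorem integral_norm_gradError_le {V : ℝ} (hV : 0 ≤ V) (ho : r.OuterAccurate V)
    (h : pb.Assumptions Lf LA D) (hs : pb.IsSolution xs) (hβ : 0 < β₀) {t : ℕ} (ht : 1 ≤ t)
    {k : ℕ} (hk : 1 ≤ k) (hkt : k ≤ epochLen t) :
    Integrable (fun ω => ‖r.gradError t k ω‖) μ ∧ ∫ ω, ‖r.gradError t k ω‖ ∂μ ≤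
      √(2 * (V + 4 * driftConst Lf LA D β₀ ^ 2)) / √((epochLen t : ℝ) + k) := by
  have hm := r.measurable_gradError h ht (ho.measurable t ht) hk hkt
  have hle := lintegral_gradError_le hV ho h hs hβ ht hk hkt
  have hL : MemLp (r.gradError t k) 2 μ := by
    refine (memLp_two_iff_integrable_sq_norm hm.aestronglyMeasurable).2
      ⟨(hm.norm.pow_const 2).aestronglyMeasurable, ?_⟩
    rw [hasFiniteIntegral_iff_enorm]
    refine lt_of_le_of_lt (le_of_eq ?_) (hle.trans_lt ENNReal.ofReal_lt_top)
    refine lintegral_congr fun ω => ?_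
    rw [enorm_pow, enorm_norm]
  refine ⟨hL.norm.integrable one_le_two, (integral_le_sqrt_integral_sq hL.norm).trans ?_⟩
  rw [← Real.sqrt_div' _ (by positivity)]
  refine Real.sqrt_le_sqrt ?_
  rw [lintegral_enorm_sq_eq hL] at hle
  exact (ENNReal.ofReal_le_ofReal_iff (by positivity)).1 hle

end HSpiderFW

/-! ### Rate constants and the scalar recursion -/

/-- The constant in the rate of the expected smoothed gap, when the outer batches have mean squared
error at most `V / K_t`. -/
def gapRate (Lf LA D β₀ gap V : ℝ) : ℝ :=
  2 * D * √(2 * (V + 4 * driftConst Lf LA D β₀ ^ 2)) + 4 * D ^ 2 * |Lf| + 2 * D ^ 2 * LA / β₀ +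
    2 * |gap|

/-- The constant in the rate of the expected squared infeasibility. -/
def sqViolRate (Lf LA D β₀ gap V l : ℝ) : ℝ :=
  8 * β₀ * gapRate Lf LA D β₀ gap V + 16 * β₀ ^ 2 * l ^ 2

/-- The constant in the rate of the algorithm. -/
def solutionRate (Lf LA D β₀ gap V l : ℝ) : ℝ :=
  gapRate Lf LA D β₀ gap V + (2 * l + 1) * √(sqViolRate Lf LA D β₀ gap V l)

theorem gapRate_nonneg {Lf LA D β₀ gap V : ℝ} (hLA : 0 ≤ LA) (hD : 0 ≤ D) (hβ : 0 < β₀) :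
    0 ≤ gapRate Lf LA D β₀ gap V := by
  rw [gapRate]
  positivity

/-- All error terms are at most C/n^{3/2}, so the next value is at most (1 - 2/n) C/√n + C/n^{3/2} =
C (n - 1)/n^{3/2}, which is below C/√(n + 1). -/
theorem recursion_step_le {a e D b c C C₁ n : ℝ} (hn : 2 ≤ n) (hD : 0 ≤ D) (hc : 0 ≤ c)
    (hC0 : 0 ≤ C) (ha : a ≤ C / √n) (he : e ≤ b / √n)
    (hC : 2 * D * b + 4 * D ^ 2 * c + 2 * D ^ 2 * C₁ ≤ C) :
    (1 - 2 / n) * a + 2 / n * D * e + (2 / n) ^ 2 * D ^ 2 * (c + C₁ * √n / 2) ≤ C / √(n + 1) := by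
  set s := √n
  set p := √(n + 1)
  have hn0 : 0 < n := by linarith
  have hss : s ^ 2 = n := Real.sq_sqrt hn0.le
  have hpp : p ^ 2 = n + 1 := Real.sq_sqrt (by linarith)
  have hs : 0 < s := Real.sqrt_pos.2 hn0
  have hp : 0 < p := Real.sqrt_pos.2 (by linarith)
  have h2n : 0 ≤ 1 - 2 / n := sub_nonneg.2 ((div_le_one hn0).2 hn)
  have hsn : s ≤ n := by nlinarith
  have h1 : (2 / n) ^ 2 * D ^ 2 * (c + C₁ * s / 2) ≤
      (4 * D ^ 2 * c + 2 * D ^ 2 * C₁) / (n * s) := by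
    have e1 : (2 / n) ^ 2 * D ^ 2 * (c + C₁ * s / 2) =
        4 * D ^ 2 * c * (1 / (n * n)) + 2 * D ^ 2 * C₁ / (n * s) := by
      rw [← hss]
      field_simp
      ring
    have h2 : 1 / (n * n) ≤ 1 / (n * s) := by gcongr
    have h3 := mul_le_mul_of_nonneg_left h2 (by positivity : 0 ≤ 4 * D ^ 2 * c)
    rw [e1, add_div]
    rw [mul_one_div _ (n * s)] at h3
    linarith
  -- Squared, this reads (n - 1)²(n + 1) ≤ n³.
  have h2 : (n - 1) * p ≤ n * s := by
    refine (pow_le_pow_iff_left₀ (mul_nonneg (by linarith) hp.le) (by positivity)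
      two_ne_zero).1 ?_
    rw [mul_pow, mul_pow, hpp, hss]
    nlinarith
  calc (1 - 2 / n) * a + 2 / n * D * e + (2 / n) ^ 2 * D ^ 2 * (c + C₁ * s / 2)
      ≤ (1 - 2 / n) * (C / s) + 2 / n * D * (b / s) +
        (4 * D ^ 2 * c + 2 * D ^ 2 * C₁) / (n * s) := by gcongr
    _ = (1 - 2 / n) * (C / s) + (2 * D * b + 4 * D ^ 2 * c + 2 * D ^ 2 * C₁) / (n * s) := by
      field_simp
      ring
    _ ≤ (1 - 2 / n) * (C / s) + C / (n * s) := by gcongr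
    _ = C * (n - 1) / (n * s) := by
      field_simp
      ring
    _ ≤ C / p := by
      rw [div_le_div_iff₀ (by positivity) hp, mul_assoc]
      gcongr

/-! ### Decreasing β, and from the smoothed gap to infeasibility and objective -/

namespace StochProblem.Assumptions

variable {d m : ℕ} {Ω Ω' : Type*} [MeasurableSpace Ω] [MeasurableSpace Ω']
  {pb : StochProblem d m Ω} {Lf LA D : ℝ} {xs : Euc d} {μ : Measure Ω'} [IsProbabilityMeasure μ]
  (h : pb.Assumptions Lf LA D)
include h

theorem integrable_obj_comp {Y : Ω' → Euc d} (hY : Measurable Y) (hYX : ∀ ω, Y ω ∈ pb.X) :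
    Integrable (fun ω => pb.obj (Y ω)) μ := by
  obtain ⟨B, hB⟩ := (h.X_compact.image h.continuous_obj).isBounded.exists_norm_le
  exact Integrable.of_bound (h.continuous_obj.measurable.comp hY).aestronglyMeasurable B
    (ae_of_all _ fun ω => hB _ ⟨_, hYX ω, rfl⟩)

theorem integrable_meanSqViol_comp (hs : pb.IsSolution xs) {Y : Ω' → Euc d} (hY : Measurable Y)
    (hYX : ∀ ω, Y ω ∈ pb.X) : Integrable (fun ω => pb.meanSqViol (Y ω)) μ :=
  Integrable.of_bound (h.measurable_meanSqViol.comp hY).aestronglyMeasurable (LA * D ^ 2)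
    (ae_of_all _ fun ω => by
      rw [Real.norm_eq_abs, abs_of_nonneg (meanSqViol_nonneg _)]
      exact h.meanSqViol_le hs (hYX ω))

theorem integrable_smoothedGap_comp (hs : pb.IsSolution xs) (β : ℝ) {Y : Ω' → Euc d}
    (hY : Measurable Y) (hYX : ∀ ω, Y ω ∈ pb.X) :
    Integrable (fun ω => pb.smoothedGap xs β (Y ω)) μ := by
  simp only [h.smoothedGap_eq hs β (hYX _)]
  exact ((h.integrable_obj_comp hY hYX).sub (integrable_const _)).add
    ((h.integrable_meanSqViol_comp hs hY hYX).const_mul _)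

theorem integral_viol_sq_prod (hs : pb.IsSolution xs) {Y : Ω' → Euc d} (hY : Measurable Y)
    (hYX : ∀ ω, Y ω ∈ pb.X) :
    Integrable (fun p : Ω' × Ω => pb.viol (Y p.1) p.2 ^ 2) (μ.prod pb.P) ∧
      ∫ p : Ω' × Ω, pb.viol (Y p.1) p.2 ^ 2 ∂(μ.prod pb.P) = ∫ ω, pb.meanSqViol (Y ω) ∂μ := by
  have hm := h.measurable_uncurry_viol.comp
    ((hY.comp (measurable_fst (β := Ω))).prodMk measurable_snd)
  simp only [Function.comp_def] at hm
  have hi : Integrable (fun p : Ω' × Ω => pb.viol (Y p.1) p.2 ^ 2) (μ.prod pb.P) := by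
    refine Integrable.of_bound (hm.pow_const 2).aestronglyMeasurable (LA * D ^ 2) ?_
    filter_upwards [Measure.quasiMeasurePreserving_snd.ae (h.viol_sq_le_ae hs)] with p hp
    rw [Real.norm_eq_abs, abs_of_nonneg (sq_nonneg _)]
    exact hp _ (hYX p.1)
  exact ⟨hi, integral_prod _ hi⟩

/-- Changing the smoothing parameter costs less than the step gains. -/
theorem smoothedGap_change_le (hs : pb.IsSolution xs) {β₀ n : ℝ} (hβ : 0 < β₀) (hn : 2 ≤ n)
    {x : Euc d} (hx : x ∈ pb.X) :
    (1 - 2 / n) * pb.smoothedGap xs (β₀ / √n) x -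
      2 / n / (2 * (β₀ / √n)) * pb.meanSqViol x ≤
    (1 - 2 / n) * pb.smoothedGap xs (β₀ / √(n - 1)) x := by
  rw [h.smoothedGap_eq hs _ hx, h.smoothedGap_eq hs _ hx]
  set s := √n with hsn
  set s' := √(n - 1) with hsn'
  have hss : s ^ 2 = n := Real.sq_sqrt (by linarith)
  have hss' : s' ^ 2 = n - 1 := Real.sq_sqrt (by linarith)
  have hs0 : 0 < s := Real.sqrt_pos.2 (by linarith)
  have hs0' : 0 < s' := Real.sqrt_pos.2 (by linarith)
  have hM := meanSqViol_nonneg (pb := pb) x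
  have hle : s' ≤ s := Real.sqrt_le_sqrt (by linarith)
  have e1 : 1 / (2 * (β₀ / s)) = s / (2 * β₀) := by field_simp
  have e2 : 1 / (2 * (β₀ / s')) = s' / (2 * β₀) := by field_simp
  have e3 : 2 / n / (2 * (β₀ / s)) = 2 / n * s / (2 * β₀) := by field_simp
  rw [e1, e2, e3]
  have h2n : 2 / n ≤ 1 := (div_le_one (by linarith)).2 hn
  -- Going from β₀/√(n-1) to β₀/√n raises the gap by (s - s') E dist²/(2β₀), and s - s' ≤ 2/s = 2s/n
  -- is covered by the surplus.
  have h1 : (1 - 2 / n) * (s - s') ≤ 2 / n * s := by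
    have h3 : s - s' ≤ 2 / n * s := by
      rw [← hss, pow_two, div_mul_eq_mul_div, mul_div_mul_right _ _ hs0.ne', le_div_iff₀ hs0]
      nlinarith
    have h4 : 0 < 2 / n := by positivity
    nlinarith
  have h5 := mul_le_mul_of_nonneg_right h1
    (div_nonneg hM (by positivity : (0 : ℝ) ≤ 2 * β₀))
  have e4 : (1 - 2 / n) * (pb.obj x - pb.obj xs + s / (2 * β₀) * pb.meanSqViol x) -
      2 / n * s / (2 * β₀) * pb.meanSqViol x =
      (1 - 2 / n) * (pb.obj x - pb.obj xs + s' / (2 * β₀) * pb.meanSqViol x) +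
      ((1 - 2 / n) * (s - s') * (pb.meanSqViol x / (2 * β₀)) -
        2 / n * s * (pb.meanSqViol x / (2 * β₀))) := by ring
  rw [e4]
  linarith

/-- The smoothed gap and the norm of a multiplier bound the infeasibility. -/
theorem meanSqViol_le_of_isMultiplier (hs : pb.IsSolution xs) {lam : Lp (Euc m) 2 pb.P}
    (hl : pb.IsMultiplier xs lam) {β : ℝ} (hβ : 0 < β) {x : Euc d} (hx : x ∈ pb.X) :
    pb.meanSqViol x ≤ 4 * β * pb.smoothedGap xs β x + 4 * β ^ 2 * ‖lam‖ ^ 2 := by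
  have h1 := h.neg_norm_mul_sqrt_le hs hl hx
  have h2 := Real.sq_sqrt (meanSqViol_nonneg (pb := pb) x)
  rw [h.smoothedGap_eq hs β hx]
  set δ := √(pb.meanSqViol x)
  have e1 : 4 * β * (pb.obj x - pb.obj xs + 1 / (2 * β) * pb.meanSqViol x) =
      4 * β * (pb.obj x - pb.obj xs) + 2 * pb.meanSqViol x := by
    field_simp
    ring
  rw [e1, ← h2]
  -- What remains after the multiplier bound is the square (δ - 2β‖λ‖)² ≥ 0.
  nlinarith [mul_le_mul_of_nonneg_left h1 hβ.le, sq_nonneg (δ - 2 * β * ‖lam‖)]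

/-- The factor 2 is needed for the lower bound, since the smoothed gap may itself be as low as
-‖λ‖δ. -/
theorem abs_obj_sub_le_of_isMultiplier (hs : pb.IsSolution xs) {lam : Lp (Euc m) 2 pb.P}
    (hl : pb.IsMultiplier xs lam) {β : ℝ} (hβ : 0 < β) {x : Euc d} (hx : x ∈ pb.X) :
    |pb.obj x - pb.obj xs| ≤
      pb.smoothedGap xs β x + 2 * ‖lam‖ * √(pb.meanSqViol x) := by
  have h1 := h.neg_norm_mul_sqrt_le hs hl hx
  rw [h.smoothedGap_eq hs β hx]
  have h2 : 0 ≤ 1 / (2 * β) * pb.meanSqViol x :=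
    mul_nonneg (by positivity) (meanSqViol_nonneg x)
  have h3 : 0 ≤ ‖lam‖ * √(pb.meanSqViol x) := by positivity
  rw [abs_le]
  constructor <;> linarith

end StochProblem.Assumptions

theorem StochProblem.IsApproxSolution.mono {d m : ℕ} {Ω Ω' : Type*} [MeasurableSpace Ω]
    [MeasurableSpace Ω'] {pb : StochProblem d m Ω} {xs : Euc d} {μ : Measure Ω'}
    {Y : Ω' → Euc d} {δ δ' : ℝ} (h : pb.IsApproxSolution xs μ Y δ) (hle : δ ≤ δ') :
    pb.IsApproxSolution xs μ Y δ' :=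
  ⟨h.1, h.2.trans hle, h.3, h.4.trans hle⟩

/-! ### Convergence of the iterates -/

namespace HSpiderFW

variable {d m : ℕ} {Ω Ω' : Type*} [MeasurableSpace Ω] [MeasurableSpace Ω']
  {pb : StochProblem d m Ω} {μ : Measure Ω'} {β₀ : ℝ} {x₁ : Euc d} {q : ℕ → ℕ}
  {r : HSpiderFW pb μ β₀ x₁ q} {Lf LA D V : ℝ} {xs : Euc d} [IsProbabilityMeasure μ]

/-- Each iterate is measured with the parameter of the step that produced it, namely n - 1. This
lets one induction cross epoch boundaries and makes β₀ itself the initial parameter. -/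
theorem integral_smoothedGap_le (hV : 0 ≤ V) (ho : r.OuterAccurate V)
    (h : pb.Assumptions Lf LA D) (hs : pb.IsSolution xs) (hβ : 0 < β₀) {t : ℕ} (ht : 1 ≤ t)
    {k : ℕ} (hk : 1 ≤ k) (hkt : k ≤ epochLen t + 1) :
    ∫ ω, pb.smoothedGap xs (β₀ / √((epochLen t : ℝ) + k - 1)) (r.x t k ω) ∂μ ≤
      gapRate Lf LA D β₀ (pb.smoothedGap xs β₀ x₁) V / √((epochLen t : ℝ) + k) := by
  set gap := pb.smoothedGap xs β₀ x₁
  have hD := h.D_nonneg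
  have hLA := h.LA_nonneg
  refine epoch_induction (motive := fun t k =>
    ∫ ω, pb.smoothedGap xs (β₀ / √((epochLen t : ℝ) + k - 1)) (r.x t k ω) ∂μ ≤
      gapRate Lf LA D β₀ gap V / √((epochLen t : ℝ) + k)) ?_ ?_ ?_ ht hk hkt
  -- The start has n = 2, and √2 ≤ 2 explains the term 2|gap| in `gapRate`.
  · simp only [r.x_start]
    have h1 : ((epochLen 1 : ℕ) : ℝ) + (1 : ℕ) - 1 = 1 := by simp [epochLen]
    have h2 : ((epochLen 1 : ℕ) : ℝ) + (1 : ℕ) = 2 := by simp [epochLen]; norm_num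
    rw [h1, h2]
    simp only [Real.sqrt_one, div_one, integral_const, probReal_univ, one_smul]
    rw [le_div_iff₀ (by positivity)]
    have h3 : √2 ≤ 2 := by
      rw [Real.sqrt_le_left (by norm_num)]
      norm_num
    have h4 : gap * √2 ≤ |gap| * 2 :=
      mul_le_mul (le_abs_self _) h3 (Real.sqrt_nonneg _) (abs_nonneg _)
    have h5 : 0 ≤ 2 * D * √(2 * (V + 4 * driftConst Lf LA D β₀ ^ 2)) + 4 * D ^ 2 * |Lf| +
      2 * D ^ 2 * LA / β₀ := by positivity
    rw [gapRate]
    linarith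
  · intro t ht h1
    have h2 : ((epochLen (t + 1) : ℕ) : ℝ) + (1 : ℕ) = epochLen t + (epochLen t + 1 : ℕ) := by
      rw [epochLen_succ ht]
      push_cast
      ring
    simp only [h2, r.x_epoch t ht]
    exact h1
  · intro t k ht hk hkt h1
    have hK1 : (1 : ℝ) ≤ epochLen t := by exact_mod_cast one_le_epochLen t
    have hk1 : (1 : ℝ) ≤ k := by exact_mod_cast hk
    have e1 : (epochLen t : ℝ) + (k + 1 : ℕ) = (epochLen t + k) + 1 := by
      push_cast
      ring
    rw [e1, add_sub_cancel_right]
    have hγ : stepSize t k = 2 / ((epochLen t : ℝ) + k) := rfl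
    have hsm : smoothPar β₀ t k = β₀ / √((epochLen t : ℝ) + k) := rfl
    obtain ⟨hei, hele⟩ := integral_norm_gradError_le hV ho h hs hβ ht hk hkt
    set n : ℝ := (epochLen t : ℝ) + k
    have hn : 2 ≤ n := by linarith
    have hX := fun ω => r.x_mem h.X_convex ht hk (by omega) ω
    have hX' := fun ω => r.x_mem h.X_convex ht (k := k + 1) (by omega) (by omega) ω
    have hi := h.integrable_smoothedGap_comp (μ := μ) hs (β₀ / √(n - 1))
      (r.measurable_x ht hk (by omega)) hX
    have hi' := h.integrable_smoothedGap_comp (μ := μ) hs (β₀ / √n)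
      (r.measurable_x ht (k := k + 1) (by omega) (by omega)) hX'
    have hstep : ∀ ω, pb.smoothedGap xs (β₀ / √n) (r.x t (k + 1) ω) ≤
        (1 - 2 / n) * pb.smoothedGap xs (β₀ / √(n - 1)) (r.x t k ω) +
        2 / n * D * ‖r.gradError t k ω‖ +
        (2 / n) ^ 2 * D ^ 2 * (|Lf| + LA / β₀ * √n / 2) := by
      intro ω
      have hn0 : 0 < √n := Real.sqrt_pos.2 (by linarith)
      obtain ⟨hw, hmin⟩ := r.w_lmo t k ht hk hkt ω
      have h2 := h.smoothedGap_step_le hs (β := β₀ / √n) (γ := 2 / n) (by positivity)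
        (hγ ▸ (stepSize_mem hk).1) (hγ ▸ (stepSize_mem hk).2) (hX ω) hw hmin
      have h3 := h.smoothedGap_change_le hs hβ hn (hX ω)
      have e2 : LA / (2 * (β₀ / √n)) = LA / β₀ * √n / 2 := by field_simp
      rw [e2] at h2
      rw [r.x_step t k ht hk hkt, hγ, gradError, hsm]
      linarith
    have i1 : Integrable (fun ω =>
        (1 - 2 / n) * pb.smoothedGap xs (β₀ / √(n - 1)) (r.x t k ω) +
        2 / n * D * ‖r.gradError t k ω‖) μ := (hi.const_mul _).add (hei.const_mul _)
    refine (integral_mono hi' (i1.add (integrable_const _)) hstep).trans ?_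
    rw [integral_add' i1 (integrable_const _), integral_add (hi.const_mul _) (hei.const_mul _),
      integral_const_mul, integral_const_mul]
    simp only [integral_const, probReal_univ, one_smul]
    refine recursion_step_le hn hD (abs_nonneg Lf) (gapRate_nonneg hLA hD hβ) h1 hele ?_
    rw [gapRate]
    have : 2 * D ^ 2 * (LA / β₀) = 2 * D ^ 2 * LA / β₀ := by ring
    linarith [abs_nonneg gap]

theorem isApproxSolution (hV : 0 ≤ V) (ho : r.OuterAccurate V)
    (h : pb.Assumptions Lf LA D) (hs : pb.IsSolution xs) (hβ : 0 < β₀)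
    {lam : Lp (Euc m) 2 pb.P} (hl : pb.IsMultiplier xs lam) {t : ℕ} (ht : 1 ≤ t)
    {k : ℕ} (hk : 1 ≤ k) (hkt : k ≤ epochLen t) :
    pb.IsApproxSolution xs μ (r.x t k)
      (solutionRate Lf LA D β₀ (pb.smoothedGap xs β₀ x₁) V ‖lam‖ / √((epochLen t : ℝ) + k)) := by
  have hgap := integral_smoothedGap_le hV ho h hs hβ ht hk (by omega)
  have hK1 : (1 : ℝ) ≤ epochLen t := by exact_mod_cast one_le_epochLen t
  have hk1 : (1 : ℝ) ≤ k := by exact_mod_cast hk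
  rw [solutionRate]
  set n : ℝ := (epochLen t : ℝ) + k
  have hn : 2 ≤ n := by linarith
  rw [sqViolRate]
  set C := gapRate Lf LA D β₀ (pb.smoothedGap xs β₀ x₁) V
  have hC : 0 ≤ C := gapRate_nonneg h.LA_nonneg h.D_nonneg hβ
  set W := 8 * β₀ * C + 16 * β₀ ^ 2 * ‖lam‖ ^ 2
  have hn0 : 0 < √n := Real.sqrt_pos.2 (by linarith)
  have hn1 : 0 < √(n - 1) := Real.sqrt_pos.2 (by linarith)
  set β := β₀ / √(n - 1)
  have hβ0 : 0 < β := by positivity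
  -- The delayed parameter is comparable with β₀/√n; the factor 2 gives the 8 and 16 of
  -- `sqViolRate`.
  have hβn : β ≤ 2 * β₀ / √n := by
    have h1 : √n ≤ 2 * √(n - 1) := by
      rw [Real.sqrt_le_left (by positivity), mul_pow, Real.sq_sqrt (by linarith)]
      linarith
    rw [div_le_div_iff₀ hn1 hn0]
    nlinarith
  have hX := fun ω => r.x_mem h.X_convex ht hk (by omega) ω
  have hm := r.measurable_x ht hk (by omega)
  have hiS := h.integrable_smoothedGap_comp (μ := μ) hs β hm hX
  have hiM := h.integrable_meanSqViol_comp (μ := μ) hs hm hX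
  have hio := h.integrable_obj_comp (μ := μ) hm hX
  have hM : ∫ ω, pb.meanSqViol (r.x t k ω) ∂μ ≤ W / n := by
    have h1 : ∫ ω, pb.meanSqViol (r.x t k ω) ∂μ ≤ 4 * β * (C / √n) + 4 * β ^ 2 * ‖lam‖ ^ 2 := by
      refine (integral_mono hiM ((hiS.const_mul (4 * β)).add (integrable_const _)) fun ω =>
        h.meanSqViol_le_of_isMultiplier hs hl hβ0 (hX ω)).trans ?_
      rw [integral_add' (hiS.const_mul _) (integrable_const _), integral_const_mul]
      simp only [integral_const, probReal_univ, one_smul]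
      gcongr
    refine h1.trans ?_
    calc 4 * β * (C / √n) + 4 * β ^ 2 * ‖lam‖ ^ 2
        ≤ 4 * (2 * β₀ / √n) * (C / √n) + 4 * (2 * β₀ / √n) ^ 2 * ‖lam‖ ^ 2 := by gcongr
      _ = W / √n ^ 2 := by
        simp only [W]
        field_simp
        ring
      _ = W / n := by rw [Real.sq_sqrt (by linarith)]
  have hsq : √(∫ ω, pb.meanSqViol (r.x t k ω) ∂μ) ≤ √W / √n := by
    rw [← Real.sqrt_div' _ (by linarith)]
    exact Real.sqrt_le_sqrt hM
  have hl0 := norm_nonneg lam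
  have hL : MemLp (fun ω => √(pb.meanSqViol (r.x t k ω))) 2 μ := by
    refine (memLp_two_iff_integrable_sq
      (h.measurable_meanSqViol.comp hm).sqrt.aestronglyMeasurable).2 ?_
    simp only [Function.comp_apply, Real.sq_sqrt (StochProblem.meanSqViol_nonneg _)]
    exact hiM
  have hE : ∫ ω, √(pb.meanSqViol (r.x t k ω)) ∂μ ≤ √W / √n := by
    refine (integral_le_sqrt_integral_sq hL).trans ?_
    simp only [Real.sq_sqrt (StochProblem.meanSqViol_nonneg _)]
    exact hsq
  have hsub : Integrable (fun ω => |pb.obj (r.x t k ω) - pb.obj xs|) μ :=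
    (hio.sub (integrable_const _)).abs
  obtain ⟨hvi, hve⟩ := h.integral_viol_sq_prod (μ := μ) hs hm hX
  refine ⟨hsub, ?_, hvi, ?_⟩
  · have hiL := (hL.integrable one_le_two).const_mul (2 * ‖lam‖)
    refine (integral_mono hsub (hiS.add hiL) fun ω =>
      h.abs_obj_sub_le_of_isMultiplier hs hl hβ0 (hX ω)).trans ?_
    rw [integral_add' hiS hiL, integral_const_mul]
    calc _ ≤ C / √n + 2 * ‖lam‖ * (√W / √n) := by gcongr
      -- The extra √W makes one constant serve both the objective and the infeasibility.
      _ ≤ C / √n + 2 * ‖lam‖ * (√W / √n) + √W / √n := by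
        have : 0 ≤ √W / √n := by positivity
        linarith
      _ = _ := by ring
  · rw [hve]
    refine hsq.trans ?_
    gcongr
    nlinarith [mul_nonneg hl0 (Real.sqrt_nonneg W)]

end HSpiderFW

/-! ### Accuracy of the outer batches in the two settings -/

namespace HSpiderFW

variable {d m : ℕ} {Ω Ω' : Type*} [MeasurableSpace Ω] [MeasurableSpace Ω']
  {μ : Measure Ω'} {β₀ : ℝ} {x₁ : Euc d} {Lf LA D : ℝ}

/-- Averaging over the full index set is the expectation under the uniform law, so every epoch
starts with zero error. -/
theorem FullOuter.outerAccurate {n : ℕ} [NeZero n] {pb : StochProblem d m (Fin n)}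
    {r : HSpiderFW pb μ β₀ x₁ (fun _ => n)} (hr : r.FullOuter)
    (hP : pb.P = (PMF.uniformOfFintype (Fin n)).toMeasure) (h : pb.Assumptions Lf LA D) :
    r.OuterAccurate 0 := by
  have hv : ∀ t, 1 ≤ t → ∀ ω, r.v t 1 ω = pb.meanGrad (smoothPar β₀ t 1) (r.x t 1 ω) := by
    intro t ht ω
    rw [r.v_outer t ht, StochProblem.batchGrad, StochProblem.meanGrad, hP, PMF.integral_eq_sum,
      Finset.smul_sum]
    simp [hr t ht ω]
  refine ⟨fun t ht => ?_, fun t ht => ?_⟩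
  · rw [funext (hv t ht)]
    have hx : Measurable[r.hist (epochLen t + 1)] (r.x t 1) :=
      (r.measurable_hist_x ht le_rfl (by omega)).mono (r.hist.mono (by omega)) le_rfl
    exact (h.measurable_meanGrad _).comp hx
  · simp [gradError, hv t ht]

/-- The penalty gradient has variance of order 1/β², and a batch of size at least 2K_t/β² absorbs
this factor. The bound β ≤ β₀ then makes the constant independent of t. -/
theorem SampledOuter.outerAccurate [IsProbabilityMeasure μ] {pb : StochProblem d m Ω}
    {r : HSpiderFW pb μ β₀ x₁ (outerBatch β₀)} (hr : r.SampledOuter)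
    (h : pb.Assumptions Lf LA D) {σ : ℝ} (hσ : pb.VarianceBound σ) {xs : Euc d}
    (hs : pb.IsSolution xs) (hβ : 0 < β₀) :
    r.OuterAccurate (σ ^ 2 * β₀ ^ 2 + 4 * (LA * D) ^ 2) := by
  refine ⟨fun t ht => ?_, fun t ht => ?_⟩
  · rw [funext (r.v_outer t ht)]
    have hx : Measurable[r.hist (epochLen t + 1)] (r.x t 1) :=
      (r.measurable_hist_x ht le_rfl (by omega)).mono (r.hist.mono (by omega)) le_rfl
    have h1 := (h.measurable_batchGrad (smoothPar β₀ t 1) (outerBatch β₀ t)).comp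
      (hx.prodMk (hr t ht).measurable)
    exact h1
  have hK : (1 : ℝ) ≤ epochLen t := by exact_mod_cast one_le_epochLen t
  set β := smoothPar β₀ t 1 with hβdef
  have hβ0 : 0 < β := by
    rw [hβdef, smoothPar]
    positivity
  have hβle : β ^ 2 ≤ β₀ ^ 2 := by
    rw [hβdef, smoothPar, div_pow, Real.sq_sqrt (by positivity)]
    refine div_le_self (sq_nonneg _) ?_
    push_cast
    linarith
  have hN : 2 * (epochLen t : ℝ) / β ^ 2 ≤ outerBatch β₀ t := Nat.le_ceil _
  have hN0 : (0 : ℝ) < outerBatch β₀ t := lt_of_lt_of_le (by positivity) hN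
  have hX := fun ω => r.x_mem h.X_convex ht le_rfl (by omega) ω
  have hcent := fun ω => h.centered_gradSmoothed (β := β) hs hσ (hX ω)
  have hg : Measurable (Function.uncurry fun (x : Euc d) ξ =>
      pb.gradSmoothed β x ξ - pb.meanGrad β x) :=
    (h.measurable_uncurry_gradSmoothed β).sub ((h.measurable_meanGrad β).comp measurable_fst)
  have hmain := (hr t ht).lintegral_enorm_add_mean_sq_le (r.hist.le _) (r.hist.le _)
    (r.measurable_hist_x ht le_rfl (by omega)) (e := fun _ => (0 : Euc d)) measurable_const hg
    (fun ω => (hcent ω).1) (fun ω => (hcent ω).2.1) (fun ω => (hcent ω).2.2)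
  have hval : ∀ ω, (0 : Euc d) + (outerBatch β₀ t : ℝ)⁻¹ • ∑ i,
      (pb.gradSmoothed β (r.x t 1 ω) (r.Q t ω i) - pb.meanGrad β (r.x t 1 ω)) =
      r.gradError t 1 ω := by
    intro ω
    rw [gradError, r.v_outer t ht, StochProblem.batchGrad, Finset.sum_sub_distrib,
      Finset.sum_const, Finset.card_univ, Fintype.card_fin, ← Nat.cast_smul_eq_nsmul ℝ, smul_sub,
      smul_smul, inv_mul_cancel₀ hN0.ne', one_smul, zero_add]
  simp only [hval] at hmain
  refine hmain.trans ?_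
  simp only [enorm_zero, ne_eq, OfNat.ofNat_ne_zero, not_false_eq_true, zero_pow, lintegral_zero,
    zero_add]
  refine ENNReal.ofReal_le_ofReal ?_
  rw [div_le_iff₀ (by positivity)] at hN
  rw [div_le_div_iff₀ hN0 (by positivity)]
  have e1 : (2 * σ ^ 2 + 8 * β⁻¹ ^ 2 * (LA * D) ^ 2) * (epochLen t : ℝ) =
      (σ ^ 2 + 4 * β⁻¹ ^ 2 * (LA * D) ^ 2) * (2 * epochLen t) := by ring
  rw [e1]
  calc (σ ^ 2 + 4 * β⁻¹ ^ 2 * (LA * D) ^ 2) * (2 * epochLen t)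
      ≤ (σ ^ 2 + 4 * β⁻¹ ^ 2 * (LA * D) ^ 2) * (outerBatch β₀ t * β ^ 2) := by gcongr
    _ = (σ ^ 2 * β ^ 2 + 4 * (LA * D) ^ 2) * outerBatch β₀ t := by
      field_simp
    _ ≤ _ := by gcongr

end HSpiderFW

/-! ### Number of epochs and oracle calls -/

section Complexity

theorem exists_pow_two_near {a : ℝ} (ha : 1 ≤ a) : ∃ T : ℕ, a ≤ 2 ^ T ∧ (2 : ℝ) ^ T ≤ 2 * a := by
  obtain ⟨n, h1, h2⟩ := exists_nat_pow_near ha one_lt_two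
  exact ⟨n + 1, h2.le, by rw [pow_succ]; linarith⟩

/-- A number of epochs after which `R / √n ≤ ε` for the later global step numbers `n`. -/
def numEpochs (R ε : ℝ) : ℕ :=
  (exists_pow_two_near (a := 1 + R ^ 2 / ε ^ 2) (le_add_of_nonneg_right (by positivity))).choose

theorem le_two_pow_numEpochs (R ε : ℝ) : 1 + R ^ 2 / ε ^ 2 ≤ 2 ^ numEpochs R ε :=
  (exists_pow_two_near (a := 1 + R ^ 2 / ε ^ 2)
    (le_add_of_nonneg_right (by positivity))).choose_spec.1

theorem two_pow_numEpochs_le {R ε : ℝ} (hε : 0 < ε) (hε1 : ε ≤ 1 / 2) :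
    (2 : ℝ) ^ numEpochs R ε ≤ 2 * (1 + R ^ 2) * (1 / ε ^ 2) := by
  refine (exists_pow_two_near (a := 1 + R ^ 2 / ε ^ 2)
    (le_add_of_nonneg_right (by positivity))).choose_spec.2.trans ?_
  have h1 : 1 ≤ 1 / ε ^ 2 := by
    rw [le_div_iff₀ (by positivity)]
    nlinarith
  rw [div_eq_mul_one_div (R ^ 2)]
  linarith

/-- After epoch T the epoch length is at least 2^T, which exceeds R²/ε². -/
theorem div_sqrt_le_of_numEpochs_lt {R ε : ℝ} (hε : 0 < ε) {t k : ℕ} (ht : numEpochs R ε < t) :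
    R / √((epochLen t : ℝ) + k) ≤ ε := by
  have h1 := le_two_pow_numEpochs R ε
  have h2 : (2 : ℝ) ^ numEpochs R ε ≤ epochLen t := by
    rw [epochLen]
    push_cast
    exact pow_le_pow_right₀ one_le_two (by omega)
  have hK : (1 : ℝ) ≤ epochLen t := by exact_mod_cast one_le_epochLen t
  have h3 : R ^ 2 / ε ^ 2 ≤ (epochLen t : ℝ) + k := by
    have : (0 : ℝ) ≤ k := k.cast_nonneg
    linarith
  rw [div_le_iff₀ (by positivity)]
  refine (le_abs_self R).trans (abs_le_of_sq_le_sq ?_ (by positivity))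
  rw [mul_pow, Real.sq_sqrt (by positivity)]
  rw [div_le_iff₀ (by positivity)] at h3
  linarith

theorem lmoCalls_le (T : ℕ) : (lmoCalls T : ℝ) ≤ 2 ^ T := by
  have h : lmoCalls T + 1 = 2 ^ T := by
    induction T with
    | zero => simp [lmoCalls]
    | succ T ih =>
      rw [lmoCalls, Finset.sum_Icc_succ_top (by omega), ← lmoCalls]
      simp only [epochLen, Finset.sum_const, Nat.card_Icc, smul_eq_mul, Nat.add_sub_cancel,
        mul_one, pow_succ]
      omega
  have h1 : (lmoCalls T : ℝ) + 1 = 2 ^ T := by exact_mod_cast h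
  linarith

theorem sum_epochLen_sq_le (T : ℕ) :
    ∑ t ∈ Finset.Icc 1 T, (epochLen t : ℝ) ^ 2 ≤ ((2 : ℝ) ^ T) ^ 2 := by
  induction T with
  | zero => simp
  | succ T ih =>
    rw [Finset.sum_Icc_succ_top (by omega)]
    simp only [epochLen, Nat.add_sub_cancel] at ih ⊢
    push_cast at ih ⊢
    rw [pow_succ (2 : ℝ) T]
    nlinarith [sq_nonneg ((2 : ℝ) ^ T)]

theorem gradCalls_le (q : ℕ → ℕ) (T : ℕ) :
    (gradCalls q T : ℝ) ≤ ∑ t ∈ Finset.Icc 1 T, (q t : ℝ) + 2 * ((2 : ℝ) ^ T) ^ 2 := by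
  rw [gradCalls]
  push_cast
  rw [Finset.sum_add_distrib]
  gcongr
  refine le_trans ?_ (mul_le_mul_of_nonneg_left (sum_epochLen_sq_le T) zero_le_two)
  rw [Finset.mul_sum]
  refine Finset.sum_le_sum fun t _ => ?_
  rw [Finset.sum_const, nsmul_eq_mul, Nat.card_Icc]
  have h1 : ((epochLen t + 1 - 2 : ℕ) : ℝ) ≤ epochLen t := by
    exact_mod_cast (by omega : epochLen t + 1 - 2 ≤ epochLen t)
  have h2 : (0 : ℝ) ≤ epochLen t := Nat.cast_nonneg _
  nlinarith

/-- Since K_t + 1 ≤ 2K_t, the ratio is at most 4K_t²/β₀²; the 1 from rounding up is at most K_t². -/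
theorem outerBatch_le {β₀ : ℝ} (hβ : 0 < β₀) (t : ℕ) :
    (outerBatch β₀ t : ℝ) ≤ (4 / β₀ ^ 2 + 1) * (epochLen t : ℝ) ^ 2 := by
  have hK : (1 : ℝ) ≤ epochLen t := by exact_mod_cast one_le_epochLen t
  have h1 : (outerBatch β₀ t : ℝ) ≤ 2 * (epochLen t : ℝ) / smoothPar β₀ t 1 ^ 2 + 1 :=
    (Nat.ceil_lt_add_one (by positivity)).le
  refine h1.trans ?_
  rw [smoothPar, div_pow, Real.sq_sqrt (by positivity), Nat.cast_one]
  have h2 : 2 * (epochLen t : ℝ) / (β₀ ^ 2 / ((epochLen t : ℝ) + 1)) ≤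
      4 / β₀ ^ 2 * (epochLen t : ℝ) ^ 2 := by
    have e1 : 2 * (epochLen t : ℝ) / (β₀ ^ 2 / ((epochLen t : ℝ) + 1)) =
        1 / β₀ ^ 2 * (2 * (epochLen t : ℝ) * (epochLen t + 1)) := by field_simp
    have e2 : 4 / β₀ ^ 2 * (epochLen t : ℝ) ^ 2 =
        1 / β₀ ^ 2 * (4 * (epochLen t : ℝ) ^ 2) := by ring
    rw [e1, e2]
    exact mul_le_mul_of_nonneg_left (by nlinarith) (by positivity)
  nlinarith

/-- The constant of the finite-sum setting, given the constant `R` of the rate. -/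
def finiteSumConst (R : ℝ) : ℝ :=
  R + 2 * (1 + R ^ 2) + 2 * (2 * (1 + R ^ 2)) ^ 2 + (Real.logb 2 (2 * (1 + R ^ 2)) + 1)

/-- The constant of the expectation setting, given the constant `R` of the rate. -/
def expectationConst (R β₀ : ℝ) : ℝ :=
  R + 2 * (1 + R ^ 2) + (4 / β₀ ^ 2 + 3) * (2 * (1 + R ^ 2)) ^ 2

variable {R ε : ℝ}

theorem logb_two_mul_one_add_sq_nonneg (R : ℝ) : 0 ≤ Real.logb 2 (2 * (1 + R ^ 2)) :=
  Real.logb_nonneg one_lt_two (by nlinarith [sq_nonneg R])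

theorem le_finiteSumConst (R : ℝ) : R ≤ finiteSumConst R := by
  have := logb_two_mul_one_add_sq_nonneg R
  rw [finiteSumConst]
  nlinarith [sq_nonneg R, sq_nonneg (2 * (1 + R ^ 2))]

theorem le_expectationConst (R β₀ : ℝ) : R ≤ expectationConst R β₀ := by
  have : 0 ≤ (4 / β₀ ^ 2 + 3) * (2 * (1 + R ^ 2)) ^ 2 := by positivity
  rw [expectationConst]
  nlinarith [sq_nonneg R]

theorem two_mul_le_finiteSumConst (hR : 0 ≤ R) : 2 * (1 + R ^ 2) ≤ finiteSumConst R := by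
  have := logb_two_mul_one_add_sq_nonneg R
  rw [finiteSumConst]
  linarith [sq_nonneg (2 * (1 + R ^ 2))]

theorem two_mul_le_expectationConst (hR : 0 ≤ R) (β₀ : ℝ) :
    2 * (1 + R ^ 2) ≤ expectationConst R β₀ :=
  le_add_of_le_of_nonneg (le_add_of_nonneg_left hR) (by positivity)

theorem two_pow_numEpochs_sq_le (hε : 0 < ε) (hε1 : ε ≤ 1 / 2) :
    ((2 : ℝ) ^ numEpochs R ε) ^ 2 ≤ (2 * (1 + R ^ 2)) ^ 2 * (1 / ε ^ 4) := by
  calc ((2 : ℝ) ^ numEpochs R ε) ^ 2 ≤ (2 * (1 + R ^ 2) * (1 / ε ^ 2)) ^ 2 := by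
        gcongr
        exact two_pow_numEpochs_le hε hε1
    _ = _ := by ring

theorem lmoCalls_numEpochs_le (hε : 0 < ε) (hε1 : ε ≤ 1 / 2) {C : ℝ}
    (hC : 2 * (1 + R ^ 2) ≤ C) : (lmoCalls (numEpochs R ε) : ℝ) ≤ C * (1 / ε ^ 2) :=
  (lmoCalls_le _).trans ((two_pow_numEpochs_le hε hε1).trans (by gcongr))

theorem gradCalls_finite_le (hR : 0 ≤ R) (hε : 0 < ε) (hε1 : ε ≤ 1 / 2) (n : ℕ) :
    (gradCalls (fun _ => n) (numEpochs R ε) : ℝ) ≤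
      finiteSumConst R * (n * Real.logb 2 (1 / ε ^ 2) + 1 / ε ^ 4) := by
  have hB := logb_two_mul_one_add_sq_nonneg R
  have h1 : 2 ≤ 1 / ε ^ 2 := by
    rw [le_div_iff₀ (by positivity)]
    nlinarith
  have hlog : 1 ≤ Real.logb 2 (1 / ε ^ 2) := by
    rw [Real.le_logb_iff_rpow_le one_lt_two (by positivity)]
    simpa using h1
  -- The logarithm of a product is a sum, and log₂(ε⁻²) ≥ 1 for ε ≤ 1/2 turns the constant summand
  -- into a factor.
  have hT : (numEpochs R ε : ℝ) ≤
      (Real.logb 2 (2 * (1 + R ^ 2)) + 1) * Real.logb 2 (1 / ε ^ 2) := by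
    have h2 : (numEpochs R ε : ℝ) ≤ Real.logb 2 (2 * (1 + R ^ 2) * (1 / ε ^ 2)) := by
      rw [Real.le_logb_iff_rpow_le one_lt_two (by positivity), Real.rpow_natCast]
      exact two_pow_numEpochs_le hε hε1
    rw [Real.logb_mul (by positivity) (by positivity)] at h2
    nlinarith
  refine (gradCalls_le _ _).trans ?_
  rw [Finset.sum_const, Nat.card_Icc, Nat.add_sub_cancel, nsmul_eq_mul]
  have hsq := two_pow_numEpochs_sq_le (R := R) hε hε1
  set l := Real.logb 2 (2 * (1 + R ^ 2)) + 1 with hl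
  set B := 2 * (1 + R ^ 2) with hBdef
  have hB0 : 0 ≤ B := by positivity
  have c1 : l ≤ finiteSumConst R := by
    rw [finiteSumConst, ← hBdef, ← hl]
    nlinarith [sq_nonneg B]
  have c2 : 2 * B ^ 2 ≤ finiteSumConst R := by
    rw [finiteSumConst, ← hBdef, ← hl]
    linarith
  have hn : (0 : ℝ) ≤ n := n.cast_nonneg
  calc (numEpochs R ε : ℝ) * n + 2 * ((2 : ℝ) ^ numEpochs R ε) ^ 2
      ≤ (l * Real.logb 2 (1 / ε ^ 2)) * n + 2 * (B ^ 2 * (1 / ε ^ 4)) := by gcongr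
    _ = l * (n * Real.logb 2 (1 / ε ^ 2)) + 2 * B ^ 2 * (1 / ε ^ 4) := by ring
    _ ≤ finiteSumConst R * (n * Real.logb 2 (1 / ε ^ 2)) + finiteSumConst R * (1 / ε ^ 4) := by
      gcongr
    _ = _ := by ring

theorem gradCalls_sampled_le (hR : 0 ≤ R) {β₀ : ℝ} (hβ : 0 < β₀) (hε : 0 < ε)
    (hε1 : ε ≤ 1 / 2) : (gradCalls (outerBatch β₀) (numEpochs R ε) : ℝ) ≤
      expectationConst R β₀ * (1 / ε ^ 4) := by
  have h1 : ∑ t ∈ Finset.Icc 1 (numEpochs R ε), (outerBatch β₀ t : ℝ) ≤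
      (4 / β₀ ^ 2 + 1) * ((2 : ℝ) ^ numEpochs R ε) ^ 2 := by
    refine (Finset.sum_le_sum fun t _ => outerBatch_le hβ t).trans ?_
    rw [← Finset.mul_sum]
    gcongr
    exact sum_epochLen_sq_le _
  calc (gradCalls (outerBatch β₀) (numEpochs R ε) : ℝ)
      ≤ (4 / β₀ ^ 2 + 3) * ((2 : ℝ) ^ numEpochs R ε) ^ 2 := by
        linarith [gradCalls_le (outerBatch β₀) (numEpochs R ε)]
    _ ≤ (4 / β₀ ^ 2 + 3) * ((2 * (1 + R ^ 2)) ^ 2 * (1 / ε ^ 4)) := by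
        gcongr
        exact two_pow_numEpochs_sq_le hε hε1
    _ = (4 / β₀ ^ 2 + 3) * (2 * (1 + R ^ 2)) ^ 2 * (1 / ε ^ 4) := by ring
    _ ≤ _ := by
        gcongr
        rw [expectationConst]
        nlinarith [sq_nonneg R]

end Complexity

theorem solutionRate_nonneg {Lf LA D β₀ gap V l : ℝ} (hLA : 0 ≤ LA) (hD : 0 ≤ D) (hβ : 0 < β₀)
    (hl : 0 ≤ l) : 0 ≤ solutionRate Lf LA D β₀ gap V l := by
  have := gapRate_nonneg (Lf := Lf) (gap := gap) (V := V) hLA hD hβ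
  rw [solutionRate]
  positivity
end

/-! ### The theorem in both settings -/

theorem corollary2 :
    -- the finite-sum setting
    (∃ (C : RateData → ℝ) (T : RateData → ℝ → ℕ),
      ∀ (d m n : ℕ) [NeZero n] (pb : StochProblem d m (Fin n)) (Lf LA D : ℝ) (xs : Euc d),
        pb.P = (PMF.uniformOfFintype (Fin n)).toMeasure →
        pb.Assumptions Lf LA D → pb.IsSolution xs →
        (∃ lam, pb.IsMultiplier xs lam) ∧
        ∀ lam, pb.IsMultiplier xs lam →
        ∀ (Ω' : Type*) [MeasurableSpace Ω'] (μ : Measure Ω') [IsProbabilityMeasure μ]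
          (β₀ : ℝ) (x₁ : Euc d) (r : HSpiderFW pb μ β₀ x₁ (fun _ => n)),
          0 < β₀ → r.FullOuter →
          ∀ c : RateData, c = ⟨Lf, LA, D, β₀, pb.smoothedGap xs β₀ x₁, ‖lam‖⟩ →
          (∀ t k, 1 ≤ t → 1 ≤ k → k ≤ epochLen t →
            pb.IsApproxSolution xs μ (r.x t k) (C c / Real.sqrt ((epochLen t : ℝ) + k))) ∧
          (∀ ε : ℝ, 0 < ε → ε ≤ 1 / 2 →
            (∀ t k, T c ε < t → 1 ≤ k → k ≤ epochLen t →
              pb.IsApproxSolution xs μ (r.x t k) ε) ∧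
            (gradCalls (fun _ => n) (T c ε) : ℝ) ≤
              C c * ((n : ℝ) * Real.logb 2 (1 / ε ^ 2) + 1 / ε ^ 4) ∧
            (lmoCalls (T c ε) : ℝ) ≤ C c * (1 / ε ^ 2))) ∧
    -- the expectation setting
    (∃ (C : RateData → ℝ → ℝ) (T : RateData → ℝ → ℝ → ℕ),
      ∀ (d m : ℕ) (Ω : Type*) [MeasurableSpace Ω] (pb : StochProblem d m Ω) (Lf LA D σ : ℝ)
        (xs : Euc d),
        pb.Assumptions Lf LA D → pb.VarianceBound σ → pb.IsSolution xs →
        (∃ lam, pb.IsMultiplier xs lam) ∧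
        ∀ lam, pb.IsMultiplier xs lam →
        ∀ (Ω' : Type*) [MeasurableSpace Ω'] (μ : Measure Ω') [IsProbabilityMeasure μ]
          (β₀ : ℝ) (x₁ : Euc d) (r : HSpiderFW pb μ β₀ x₁ (outerBatch β₀)),
          0 < β₀ → r.SampledOuter →
          ∀ c : RateData, c = ⟨Lf, LA, D, β₀, pb.smoothedGap xs β₀ x₁, ‖lam‖⟩ →
          (∀ t k, 1 ≤ t → 1 ≤ k → k ≤ epochLen t →
            pb.IsApproxSolution xs μ (r.x t k) (C c σ / Real.sqrt ((epochLen t : ℝ) + k))) ∧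
          (∀ ε : ℝ, 0 < ε → ε ≤ 1 / 2 →
            (∀ t k, T c σ ε < t → 1 ≤ k → k ≤ epochLen t →
              pb.IsApproxSolution xs μ (r.x t k) ε) ∧
            (gradCalls (outerBatch β₀) (T c σ ε) : ℝ) ≤ C c σ * (1 / ε ^ 4) ∧
            (lmoCalls (T c σ ε) : ℝ) ≤ C c σ * (1 / ε ^ 2))) := by
  -- The settings differ only in the initial error V/K_t of an epoch: V is 0 for full batches and
  -- σ²β₀² + 4(LA·D)² for sampled ones.
  refine ⟨⟨fun c => finiteSumConst (solutionRate c.Lf c.LA c.D c.β₀ c.gap 0 c.lamNorm),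
    fun c ε => numEpochs (solutionRate c.Lf c.LA c.D c.β₀ c.gap 0 c.lamNorm) ε, ?_⟩,
    ⟨fun c σ => expectationConst (solutionRate c.Lf c.LA c.D c.β₀ c.gap
        (σ ^ 2 * c.β₀ ^ 2 + 4 * (c.LA * c.D) ^ 2) c.lamNorm) c.β₀,
      fun c σ ε => numEpochs (solutionRate c.Lf c.LA c.D c.β₀ c.gap
        (σ ^ 2 * c.β₀ ^ 2 + 4 * (c.LA * c.D) ^ 2) c.lamNorm) ε, ?_⟩⟩
  · intro d m n _ pb Lf LA D xs hP h hs
    refine ⟨h.exists_isMultiplier hs, ?_⟩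
    intro lam hl Ω' _ μ _ β₀ x₁ r hβ hr c hc
    subst hc
    have ho := hr.outerAccurate hP h
    have hsol := fun {t k : ℕ} (ht : 1 ≤ t) (hk : 1 ≤ k) (hkt : k ≤ epochLen t) =>
      HSpiderFW.isApproxSolution le_rfl ho h hs hβ hl ht hk hkt
    have hR := solutionRate_nonneg (Lf := Lf) (gap := pb.smoothedGap xs β₀ x₁) (V := 0)
      h.LA_nonneg h.D_nonneg hβ (norm_nonneg lam)
    refine ⟨fun t k ht hk hkt => (hsol ht hk hkt).mono ?_, fun ε hε hε1 =>
      ⟨fun t k ht hk hkt => (hsol (by omega) hk hkt).mono (div_sqrt_le_of_numEpochs_lt hε ht),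
        gradCalls_finite_le hR hε hε1 n, lmoCalls_numEpochs_le hε hε1 ?_⟩⟩
    · gcongr
      exact le_finiteSumConst _
    · exact two_mul_le_finiteSumConst hR
  · intro d m Ω _ pb Lf LA D σ xs h hσ hs
    refine ⟨h.exists_isMultiplier hs, ?_⟩
    intro lam hl Ω' _ μ _ β₀ x₁ r hβ hr c hc
    subst hc
    have ho := hr.outerAccurate h hσ hs hβ
    have hsol := fun {t k : ℕ} (ht : 1 ≤ t) (hk : 1 ≤ k) (hkt : k ≤ epochLen t) =>
      HSpiderFW.isApproxSolution (by positivity) ho h hs hβ hl ht hk hkt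
    have hR := solutionRate_nonneg (Lf := Lf) (gap := pb.smoothedGap xs β₀ x₁)
      (V := σ ^ 2 * β₀ ^ 2 + 4 * (LA * D) ^ 2)
      h.LA_nonneg h.D_nonneg hβ (norm_nonneg lam)
    refine ⟨fun t k ht hk hkt => (hsol ht hk hkt).mono ?_, fun ε hε hε1 =>
      ⟨fun t k ht hk hkt => (hsol (by omega) hk hkt).mono (div_sqrt_le_of_numEpochs_lt hε ht),
        gradCalls_sampled_le hR hβ hε hε1, lmoCalls_numEpochs_le hε hε1 ?_⟩⟩
    · gcongr
      exact le_expectationConst _ _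
    · exact two_mul_le_expectationConst hR _
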